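/- Let $(M,g_M,\sigma_M)$ be a magnetic system: $(M,g_M)$ is a closed (compact, without boundary), connected smooth Riemannian manifold and $\sigma_M$ is a smooth closed two-form on $M$. Its Lorentz force is the bundle endomorphism $Y^M\colon TM\to TM$ with $g_M(Y^M u,v)=\sigma_M(u,v)$, and a magnetic geodesic is a smooth curve $\gamma\colon J\to M$ on an open interval $J$ with $\nabla^M_{\dot\gamma}\dot\gamma=Y^M\dot\gamma$, where $\nabla^M$ is the Levi-Civita connection of $g_M$. Let $N\subset M$ be a closed embedded smooth submanifold with inclusion $\iota\colon N\to M$, let $g_N:=\iota^*g_M$, $\sigma_N:=\iota^*\sigma_M$, and define $\nabla^N$, $Y^N$ and the magnetic geodesics of $(N,g_N,\sigma_N)$ in the same way. The second fundamental form of $N$ is $\mathrm{II}_q(v):=\nabla^M_vV-\nabla^N_vV$ for $q\in N$, $v\in T_qN$, where $V$ is any local vector field tangent to $N$ with $V(q)=v$. The submanifold $N$ is called totally magnetic in $(M,g_M,\sigma_M)$ if for every magnetic geodesic $\gamma\colon J\to M$ with $0\in J$, $\gamma(0)\in N$ and $\dot\gamma(0)\in T_{\gamma(0)}N$ there is $\varepsilon>0$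 with $(-\varepsilon,\varepsilon)\subset J$ and $\gamma((-\varepsilon,\varepsilon))\subset N$. Then the following statements are equivalent: 1. $N$ is totally magnetic in $(M,g_M,\sigma_M)$. 2. If $\gamma$ is a magnetic geodesic of $(N,g_N,\sigma_N)$, then $\iota\circ\gamma$ is a magnetic geodesic of $(M,g_M,\sigma_M)$. 3. $\mathrm{II}_q(v)=0$ for all $(q,v)\in TN$, and one of the conditions (a), (b), (c) below holds. Moreover, the following three conditions are equivalent to each other: (a) $Y^N_qv=Y^M_qv$ for all $(q,v)\in TN$; (b) $Y^M_qv\in T_qN$ for all $(q,v)\in TN$; (c) $(\sigma_M)_q(u,v)=0$ for all $q\in N$, $u\in T_qN$ and $v\in T_qN^{\perp}$, where $T_qN^\perp$ is the $g_M$-orthogonal complement of $T_qN$ in $T_qM$. -/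

import Mathlib

open scoped Manifold ContDiff

noncomputable section

namespace Magnetic

/-! Manifolds without boundary are modelled on a finite-dimensional normed space `E` through
`𝓘(ℝ, E)`. -/

/-- A (not necessarily continuous) field of bilinear forms on the tangent spaces of `M`. -/
abbrev TwoTensor (E : Type*) [NormedAddCommGroup E] [NormedSpace ℝ E]
    (M : Type*) [TopologicalSpace M] [ChartedSpace E M] :=
  (x : M) → TangentSpace 𝓘(ℝ, E) x →L[ℝ] TangentSpace 𝓘(ℝ, E) x →L[ℝ] ℝ

/-- The pullback `(u, v) ↦ B (A u) (A v)` of a bilinear form. -/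
def bilinPullback {V W : Type*}
    [AddCommGroup V] [Module ℝ V] [TopologicalSpace V]
    [AddCommGroup W] [Module ℝ W] [TopologicalSpace W]
    (B : W →L[ℝ] W →L[ℝ] ℝ) (A : V →L[ℝ] W) : V →L[ℝ] V →L[ℝ] ℝ :=
  (ContinuousLinearMap.precomp ℝ A).comp (B.comp A)

theorem bilinPullback_apply {V W : Type*}
    [AddCommGroup V] [Module ℝ V] [TopologicalSpace V]
    [AddCommGroup W] [Module ℝ W] [TopologicalSpace W]
    (B : W →L[ℝ] W →L[ℝ] ℝ) (A : V →L[ℝ] W) (u v : V) :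
    bilinPullback B A u v = B (A u) (A v) := rfl

section Manifold

variable {E : Type*} [NormedAddCommGroup E] [NormedSpace ℝ E]
  {M : Type*} [TopologicalSpace M] [ChartedSpace E M] [IsManifold 𝓘(ℝ, E) ∞ M]
  {F : Type*} [NormedAddCommGroup F] [NormedSpace ℝ F]
  {N : Type*} [TopologicalSpace N] [ChartedSpace F N] [IsManifold 𝓘(ℝ, F) ∞ N]

/-! ### Tensors, Christoffel symbols and the Levi-Civita connection in charts -/

/-- The coordinates of the tangent vector `w ∈ T_x M` in the preferred chart `φ_q` around `q`,
i.e. `dφ_q(x) w ∈ E`, for `x` in the domain of `φ_q`. -/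
def coord (q : M) (x : M) (w : TangentSpace 𝓘(ℝ, E) x) : E :=
  ((trivializationAt E (TangentSpace 𝓘(ℝ, E) : M → Type _) q)
    (⟨x, w⟩ : TangentBundle 𝓘(ℝ, E) M)).2

/-- The tangent vector in `T_x M` with given coordinates in the preferred chart `φ_q` around `q`,
for `x` in the domain of `φ_q`. -/
def ofCoord (q : M) (x : M) : E →L[ℝ] TangentSpace 𝓘(ℝ, E) x :=
  (trivializationAt E (TangentSpace 𝓘(ℝ, E) : M → Type _) q).symmL ℝ x

/-- The coordinate expression of `B` in the preferred chart around `q`: the function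
`y ↦ (B_{ij}(y))` on the target of the chart, with values in the bilinear forms on `E`. -/
def inChart (B : TwoTensor E M) (q : M) (y : E) : E →L[ℝ] E →L[ℝ] ℝ :=
  bilinPullback (B ((extChartAt 𝓘(ℝ, E) q).symm y))
    (ofCoord q ((extChartAt 𝓘(ℝ, E) q).symm y))

/-- The partial derivatives `(w, u, v) ↦ w^k u^i v^j ∂_k B_{ij}` of the coordinate expression of
`B` in the preferred chart around `q`, at the point `q`. -/
def dInChart (B : TwoTensor E M) (q : M) : E →L[ℝ] E →L[ℝ] E →L[ℝ] ℝ :=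
  fderiv ℝ (inChart B q) (extChartAt 𝓘(ℝ, E) q q)

/-- The Christoffel symbols of the first kind of `g` in the preferred chart around `q`, at `q`,
contracted with `u` and `v`: the covector
`w ↦ ½ (∂_u g(v, w) + ∂_v g(u, w) - ∂_w g(u, v))`. -/
def christoffelFirst (g : TwoTensor E M) (q : M) (u v : E) : E →L[ℝ] ℝ :=
  (1 / 2 : ℝ) • (dInChart g q u v + dInChart g q v u - ((dInChart g q).flip u).flip v)

/-- The Christoffel symbols (of the second kind) `Γ(u, v) = (Γ^k_{ij} u^i v^j)_k` of `g` in the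
preferred chart around `q`, at `q`. Here the inverse is that of `u ↦ g(u, ·)`. -/
def christoffel (g : TwoTensor E M) (q : M) (u v : E) : E :=
  (inChart g q (extChartAt 𝓘(ℝ, E) q q)).inverse (christoffelFirst g q u v)

/-- The Levi-Civita connection of `(M, g)` on vector fields along a map `f : N → M`: for a vector
field `V` along `f` and `v ∈ T_q N`, this is the vector `∇_v V ∈ T_{f q} M` whose coordinates in
the chart around `f q` are `∂_v V^k + Γ^k_{ij} (df v)^i V^j`. For `f = id` it is the Levi-Civita
connection itself, and for a curve `f` it is the covariant derivative along the curve. -/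
def covDerivAlong (g : TwoTensor E M) (f : N → M)
    (V : (p : N) → TangentSpace 𝓘(ℝ, E) (f p)) (q : N) (v : TangentSpace 𝓘(ℝ, F) q) :
    TangentSpace 𝓘(ℝ, E) (f q) :=
  ofCoord (f q) (f q)
    (mvfderiv 𝓘(ℝ, F) (fun p => coord (f q) (f p) (V p)) q v
      + christoffel g (f q) (coord (f q) (f q) (mfderiv 𝓘(ℝ, F) 𝓘(ℝ, E) f q v))
          (coord (f q) (f q) (V q)))

/-- The Levi-Civita connection `∇_v X` of `(M, g)`. -/
def leviCivita (g : TwoTensor E M) (X : (p : M) → TangentSpace 𝓘(ℝ, E) p) (q : M)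
    (v : TangentSpace 𝓘(ℝ, E) q) : TangentSpace 𝓘(ℝ, E) q :=
  covDerivAlong g (fun p : M => p) X q v

/-! ### Magnetic systems and magnetic geodesics -/

variable (E M) in
/-- A magnetic system on `M`: a smooth Riemannian metric `g` and a smooth closed two-form `σ`. -/
structure MagneticSystem where
  /-- The Riemannian metric. -/
  metric : Bundle.ContMDiffRiemannianMetric 𝓘(ℝ, E) ∞ E
    (fun x : M => TangentSpace 𝓘(ℝ, E) x)
  /-- The magnetic field. -/
  field : TwoTensor E M
  field_alt : ∀ (x : M) (v : TangentSpace 𝓘(ℝ, E) x), field x v v = 0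
  field_smooth : ContMDiff 𝓘(ℝ, E) (𝓘(ℝ, E).prod 𝓘(ℝ, E →L[ℝ] E →L[ℝ] ℝ)) ∞
    (fun x => Bundle.TotalSpace.mk' (E →L[ℝ] E →L[ℝ] ℝ)
      (E := fun x : M => TangentSpace 𝓘(ℝ, E) x →L[ℝ] TangentSpace 𝓘(ℝ, E) x →L[ℝ] ℝ)
      x (field x))
  /-- `dσ = 0`, in the coordinates around `q`: `∂_u σ(v, w) - ∂_v σ(u, w) + ∂_w σ(u, v) = 0`. -/
  field_closed : ∀ (q : M) (u v w : E),
    dInChart field q u v w - dInChart field q v u w + dInChart field q w u v = 0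

/-- The Lorentz force `Y` of `(M, g, σ)`: the endomorphism with `g (Y u) v = σ u v`. -/
def lorentzForce (g σ : TwoTensor E M) (q : M) :
    TangentSpace 𝓘(ℝ, E) q →L[ℝ] TangentSpace 𝓘(ℝ, E) q :=
  (g q).inverse.comp (σ q)

/-- The velocity `γ̇(t)` of a curve in `M`. -/
def velocity (γ : ℝ → M) (t : ℝ) : TangentSpace 𝓘(ℝ, E) (γ t) :=
  mfderiv 𝓘(ℝ, ℝ) 𝓘(ℝ, E) γ t (1 : ℝ)

/-- `γ : J → M` is a magnetic geodesic of `(M, g, σ)` on the open interval `J`: a smooth curve with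
`∇_γ̇ γ̇ = Y γ̇`. The values of `γ` outside `J` are irrelevant. -/
structure IsMagneticGeodesicOn (g σ : TwoTensor E M) (γ : ℝ → M) (J : Set ℝ) : Prop where
  isOpen : IsOpen J
  ordConnected : J.OrdConnected
  smooth : ContMDiffOn 𝓘(ℝ, ℝ) 𝓘(ℝ, E) ∞ γ J
  equation : ∀ t ∈ J,
    covDerivAlong (F := ℝ) (N := ℝ) g γ (fun s => velocity γ s) t (1 : ℝ)
      = lorentzForce g σ (γ t) (velocity γ t)

/-- The pullback `f^* B` of a field of bilinear forms under `f : N → M`. -/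
def pullbackTensor (f : N → M) (B : TwoTensor E M) : TwoTensor F N :=
  fun q => bilinPullback (B (f q)) (mfderiv 𝓘(ℝ, F) 𝓘(ℝ, E) f q)

end Manifold

/-! ### Submanifolds -/

section Submanifold

variable {E : Type*} [NormedAddCommGroup E] [NormedSpace ℝ E]
  {M : Type*} [TopologicalSpace M] [ChartedSpace E M] [IsManifold 𝓘(ℝ, E) ∞ M]
  (F : Type*) [NormedAddCommGroup F] [NormedSpace ℝ F]
  (N : Set M) [ChartedSpace F N] [IsManifold 𝓘(ℝ, F) ∞ N]

/-- The differential `dι_q : T_q N → T_q M` of the inclusion `ι : N → M`. -/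
def dIncl (q : N) : TangentSpace 𝓘(ℝ, F) q →L[ℝ] TangentSpace 𝓘(ℝ, E) (q : M) :=
  mfderiv 𝓘(ℝ, F) 𝓘(ℝ, E) (Subtype.val : N → M) q

/-- The tangent space `T_q N`, as a subspace of `T_q M`. -/
def tangentSubspace (q : N) : Submodule ℝ (TangentSpace 𝓘(ℝ, E) (q : M)) :=
  (dIncl F N q).toLinearMap.range

/-- The pullback `ι^* B` to `N` of a field of bilinear forms on `M`. -/
def restrictTensor (B : TwoTensor E M) : TwoTensor F N :=
  pullbackTensor (Subtype.val : N → M) B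

/-- The second fundamental form of `N` in `(M, g)`:
`II_q(v) = ∇^M_v V - ∇^N_v V`, where `V` is the vector field tangent to `N` that extends `v` and
has constant coefficients in the chart of `N` around `q` (the value does not depend on the choice
of the extension). -/
def secondFundamentalForm (g : TwoTensor E M) (q : N) (v : TangentSpace 𝓘(ℝ, F) q) :
    TangentSpace 𝓘(ℝ, E) (q : M) :=
  let V : (p : N) → TangentSpace 𝓘(ℝ, F) p := fun p => ofCoord q p (coord q q v)
  covDerivAlong g (Subtype.val : N → M) (fun p => dIncl F N p (V p)) q v
    - dIncl F N q (leviCivita (restrictTensor F N g) V q v)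

/-- `N` is totally magnetic in `(M, g, σ)`: every magnetic geodesic `γ : J → M`, `0 ∈ J`, with
`γ(0) ∈ N` and `γ̇(0) ∈ T_{γ(0)} N` satisfies `γ((-ε, ε)) ⊆ N` for some `ε > 0`. -/
def IsTotallyMagnetic (g σ : TwoTensor E M) : Prop :=
  ∀ (γ : ℝ → M) (J : Set ℝ), IsMagneticGeodesicOn g σ γ J → (0 : ℝ) ∈ J →
    ∀ h : γ 0 ∈ N, velocity (E := E) γ 0 ∈ tangentSubspace (E := E) F N ⟨γ 0, h⟩ →
      ∃ ε > 0, Set.Ioo (-ε) ε ⊆ J ∧ ∀ t ∈ Set.Ioo (-ε) ε, γ t ∈ N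

/-- The second fundamental form of `N` vanishes identically. -/
def SecondFundamentalFormVanishes (g : TwoTensor E M) : Prop :=
  ∀ (q : N) (v : TangentSpace 𝓘(ℝ, F) q), secondFundamentalForm F N g q v = 0

/-- The Lorentz forces of `(N, ι^* g, ι^* σ)` and of `(M, g, σ)` coincide on `TN`:
`Y^N v = Y^M v` for all `v ∈ TN`. -/
def LorentzForcesAgree (g σ : TwoTensor E M) : Prop :=
  ∀ (q : N) (v : TangentSpace 𝓘(ℝ, F) q),
    dIncl F N q (lorentzForce (restrictTensor F N g) (restrictTensor F N σ) q v)
      = lorentzForce g σ (q : M) (dIncl F N q v)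

/-- The Lorentz force of `(M, g, σ)` leaves `TN` invariant. -/
def LorentzForcePreservesTangent (g σ : TwoTensor E M) : Prop :=
  ∀ (q : N), ∀ v ∈ tangentSubspace (E := E) F N q,
    lorentzForce g σ (q : M) v ∈ tangentSubspace (E := E) F N q

/-- The `g`-orthogonal of `TN` is contained in its `σ`-orthogonal: `σ(u, v) = 0` for all
`u ∈ T_q N` and `v ∈ T_q N^⊥`. -/
def NormalIsFieldOrthogonal (g σ : TwoTensor E M) : Prop :=
  ∀ (q : N), ∀ u ∈ tangentSubspace (E := E) F N q, ∀ v : TangentSpace 𝓘(ℝ, E) (q : M),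
    (∀ w ∈ tangentSubspace (E := E) F N q, g (q : M) w v = 0) → σ (q : M) u v = 0

end Submanifold

end Magnetic

end

open scoped Manifold ContDiff

noncomputable section

namespace Magnetic

/-! For a curve in `N` with velocity `v`, the Gauss formula says that its acceleration in `M` is its
acceleration in `N` plus `II(v)`. Hence a magnetic geodesic of `M` lying in `N` that also solves the
equation of `N` gives `Y^N v + II(v) = Y^M v`. If this holds for every `v`, replacing `v` by `-v`
separates the even term `II` from the odd Lorentz terms: `II = 0` and `Y^N = Y^M` on `TN`
(`secondFundamentalFormVanishes_and_lorentzForcesAgree_iff`). Conversely, these two identities and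
the Gauss formula make magnetic geodesics of `N` magnetic geodesics of `M`.

If `N` is totally magnetic, the magnetic geodesic of `M` with initial velocity `v ∈ TN` runs in `N`
for a short time, and the relation is read off at time `0`. If magnetic geodesics of `N` are
magnetic geodesics of `M`, then existence in `N` and uniqueness in `M` give total magneticity. The
equivalence of (a), (b), (c) is linear algebra: `Y^N v` is the orthogonal projection of `Y^M v` to
`TN`.

The computations rest on `magneticDefect`, the geodesic equation with its index lowered to a
covector. It involves no inverse metric, so it pulls back along every smooth map
(`magneticDefect_pullback`). The identity map gives independence of the chart; the inclusion shows
that a magnetic geodesic of `M` lying in `N` solves the equation of `N`, without adapted charts or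
projections. -/

open Set Filter Topology

/-! ### The lowered geodesic equation on normed spaces and its naturality. -/

section Flat

variable {V W : Type*} [NormedAddCommGroup V] [NormedSpace ℝ V]
  [NormedAddCommGroup W] [NormedSpace ℝ W]

/-- The Christoffel symbols of the first kind of a field `G` of bilinear forms on a normed space. -/
def flatChristoffelFirst (G : V → V →L[ℝ] V →L[ℝ] ℝ) (x u v : V) : V →L[ℝ] ℝ :=
  (1 / 2 : ℝ) • (fderiv ℝ G x u v + fderiv ℝ G x v u - ((fderiv ℝ G x).flip u).flip v)

/-- The magnetic geodesic equation of `(G, S)` for the curve `x`, with the index lowered: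
`G(ẍ + Γ(ẋ, ẋ), ·) - S(ẋ, ·)`. -/
def magneticDefect (G S : V → V →L[ℝ] V →L[ℝ] ℝ) (x : ℝ → V) (t : ℝ) : V →L[ℝ] ℝ :=
  G (x t) (deriv (deriv x) t) + flatChristoffelFirst G (x t) (deriv x t) (deriv x t)
    - S (x t) (deriv x t)

theorem flatChristoffelFirst_self_apply (G : V → V →L[ℝ] V →L[ℝ] ℝ) (x u w : V) :
    flatChristoffelFirst G x u u w = fderiv ℝ G x u u w - (1 / 2 : ℝ) * fderiv ℝ G x w u u := by
  simp [flatChristoffelFirst]; ring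

theorem contDiffAt_bilinPullback {X : Type*} [NormedAddCommGroup X] [NormedSpace ℝ X] {n : ℕ∞ω}
    {B : X → W →L[ℝ] W →L[ℝ] ℝ} {A : X → V →L[ℝ] W} {x : X}
    (hB : ContDiffAt ℝ n B x) (hA : ContDiffAt ℝ n A x) :
    ContDiffAt ℝ n (fun y => bilinPullback (B y) (A y)) x := by
  have h : (fun y => bilinPullback (B y) (A y)) =
      fun y => ((ContinuousLinearMap.compL ℝ V W ℝ).flip (A y)).comp ((B y).comp (A y)) := by
    ext y u v; rfl
  rw [h]
  exact ((ContinuousLinearMap.contDiff _).contDiffAt.comp x hA).clm_comp (hB.clm_comp hA)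

/-- The derivative of a pulled-back field of bilinear forms. -/
theorem fderiv_pullback_apply {G : W → W →L[ℝ] W →L[ℝ] ℝ} {G' : V → V →L[ℝ] V →L[ℝ] ℝ}
    {f : V → W} {x : V} (hG : ContDiffAt ℝ 1 G (f x)) (hf : ContDiffAt ℝ 2 f x)
    (h : G' =ᶠ[𝓝 x] fun y => bilinPullback (G (f y)) (fderiv ℝ f y)) (a b c : V) :
    fderiv ℝ G' x a b c =
      fderiv ℝ G (f x) (fderiv ℝ f x a) (fderiv ℝ f x b) (fderiv ℝ f x c)
      + G (f x) (fderiv ℝ (fderiv ℝ f) x a b) (fderiv ℝ f x c)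
      + G (f x) (fderiv ℝ f x b) (fderiv ℝ (fderiv ℝ f) x a c) := by
  have hf1 : ContDiffAt ℝ 1 f x := hf.of_le (by norm_num)
  have hf' : ContDiffAt ℝ 1 (fderiv ℝ f) x := hf.fderiv_right (by norm_num)
  have hGf : ContDiffAt ℝ 1 (fun y => G (f y)) x := hG.comp x hf1
  have hG' : DifferentiableAt ℝ G' x :=
    (((contDiffAt_bilinPullback hGf hf').differentiableAt one_ne_zero)).congr_of_eventuallyEq h
  have dG : HasFDerivAt (fun y => G (f y)) ((fderiv ℝ G (f x)).comp (fderiv ℝ f x)) x :=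
    (hG.differentiableAt one_ne_zero).hasFDerivAt.comp x
      (hf1.differentiableAt one_ne_zero).hasFDerivAt
  have df := (hf'.differentiableAt one_ne_zero).hasFDerivAt
  have e1 := (hG'.hasFDerivAt.clm_apply (hasFDerivAt_const b x)).clm_apply
    (hasFDerivAt_const c x)
  have db := df.clm_apply (hasFDerivAt_const b x)
  have dc := df.clm_apply (hasFDerivAt_const c x)
  have e2 := (dG.clm_apply db).clm_apply dc
  have e3 : (fun y => G' y b c) =ᶠ[𝓝 x] fun y => G (f y) (fderiv ℝ f y b) (fderiv ℝ f y c) := by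
    filter_upwards [h] with y hy
    rw [hy]; rfl
  have e4 := congrArg (fun l : V →L[ℝ] ℝ => l a) (e1.unique (e2.congr_of_eventuallyEq e3))
  simp at e4
  rw [e4]; ring

/-- The transformation law of the Christoffel symbols. -/
theorem flatChristoffelFirst_pullback {G : W → W →L[ℝ] W →L[ℝ] ℝ} {G' : V → V →L[ℝ] V →L[ℝ] ℝ}
    {f : V → W} {x : V} (hG : ContDiffAt ℝ 1 G (f x)) (hf : ContDiffAt ℝ 2 f x)
    (hs : ∀ a b, G (f x) a b = G (f x) b a)
    (h : G' =ᶠ[𝓝 x] fun y => bilinPullback (G (f y)) (fderiv ℝ f y)) (u w : V) :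
    flatChristoffelFirst G' x u u w =
      G (f x) (fderiv ℝ (fderiv ℝ f) x u u) (fderiv ℝ f x w)
      + flatChristoffelFirst G (f x) (fderiv ℝ f x u) (fderiv ℝ f x u) (fderiv ℝ f x w) := by
  -- The Hessian terms that pair `D²f(u, w)` with `Df u` cancel, by the symmetry of `D²f` and of
  -- `G`; only the term with `D²f(u, u)` survives.
  have hsym : fderiv ℝ (fderiv ℝ f) x u w = fderiv ℝ (fderiv ℝ f) x w u :=
    (hf.isSymmSndFDerivAt (by simp)) u w
  rw [flatChristoffelFirst_self_apply, flatChristoffelFirst_self_apply,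
    fderiv_pullback_apply hG hf h, fderiv_pullback_apply hG hf h, hsym,
    hs (fderiv ℝ (fderiv ℝ f) x w u)]
  ring

theorem deriv_comp_eventuallyEq {f : V → W} {x : ℝ → V} {t : ℝ} (hf : ContDiffAt ℝ 2 f (x t))
    (hx : ContDiffAt ℝ 2 x t) :
    deriv (f ∘ x) =ᶠ[𝓝 t] fun s => fderiv ℝ f (x s) (deriv x s) := by
  have h1 : ∀ᶠ s in 𝓝 t, ContDiffAt ℝ 2 f (x s) :=
    hx.continuousAt.eventually (hf.eventually (by simp))
  filter_upwards [h1, hx.eventually (by simp)] with s hs hs'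
  exact fderiv_comp_deriv s (hs.differentiableAt two_ne_zero) (hs'.differentiableAt two_ne_zero)

theorem deriv_deriv_comp {f : V → W} {x : ℝ → V} {t : ℝ} (hf : ContDiffAt ℝ 2 f (x t))
    (hx : ContDiffAt ℝ 2 x t) :
    deriv (deriv (f ∘ x)) t = fderiv ℝ (fderiv ℝ f) (x t) (deriv x t) (deriv x t)
      + fderiv ℝ f (x t) (deriv (deriv x) t) := by
  rw [(deriv_comp_eventuallyEq hf hx).deriv_eq]
  have hf' : ContDiffAt ℝ 1 (fderiv ℝ f) (x t) := hf.fderiv_right (by norm_num)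
  have d1 : HasDerivAt x (deriv x t) t := (hx.differentiableAt two_ne_zero).hasDerivAt
  have d2 : HasDerivAt (deriv x) (deriv (deriv x) t) t := by
    exact (hx.derivWithin (m := 1) (by norm_num)).differentiableAt one_ne_zero |>.hasDerivAt
  have d3 := (hf'.differentiableAt one_ne_zero).hasFDerivAt.comp_hasDerivAt t d1
  exact (d3.clm_apply d2).deriv

/-- The lowered magnetic geodesic equation is natural with respect to smooth maps. -/
theorem magneticDefect_pullback {G S : W → W →L[ℝ] W →L[ℝ] ℝ} {G' S' : V → V →L[ℝ] V →L[ℝ] ℝ}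
    {f : V → W} {x : ℝ → V} {t : ℝ} (hG : ContDiffAt ℝ 1 G (f (x t)))
    (hf : ContDiffAt ℝ 2 f (x t)) (hx : ContDiffAt ℝ 2 x t)
    (hs : ∀ a b, G (f (x t)) a b = G (f (x t)) b a)
    (h : G' =ᶠ[𝓝 (x t)] fun y => bilinPullback (G (f y)) (fderiv ℝ f y))
    (h' : S' (x t) = bilinPullback (S (f (x t))) (fderiv ℝ f (x t))) (w : V) :
    magneticDefect G' S' x t w = magneticDefect G S (f ∘ x) t (fderiv ℝ f (x t) w) := by
  simp only [magneticDefect, sub_apply, add_apply]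
  rw [flatChristoffelFirst_pullback hG hf hs h, h', h.self_of_nhds, deriv_deriv_comp hf hx,
    (deriv_comp_eventuallyEq hf hx).self_of_nhds, bilinPullback_apply, bilinPullback_apply]
  simp only [Function.comp_apply, map_add, add_apply]
  ring

end Flat

/-! ### Local existence, smoothness and uniqueness for the geodesic equation on an open subset of a
normed space. -/

section Ode

variable {V : Type*} [NormedAddCommGroup V] [NormedSpace ℝ V]

/-- The acceleration `S(x)^♯ u - Γ(x)(u, u)` of a magnetic geodesic through `x` with velocity `u`. -/
def magneticAcceleration (G S : V → V →L[ℝ] V →L[ℝ] ℝ) (p : V × V) : V :=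
  (G p.1).inverse (S p.1 p.2 - flatChristoffelFirst G p.1 p.2 p.2)

theorem magneticDefect_eq_zero_iff {G S : V → V →L[ℝ] V →L[ℝ] ℝ} {x : ℝ → V} {t : ℝ}
    (h : (G (x t)).IsInvertible) :
    magneticDefect G S x t = 0 ↔
      deriv (deriv x) t = magneticAcceleration G S (x t, deriv x t) := by
  obtain ⟨e, he⟩ := h
  simp only [magneticDefect, magneticAcceleration]
  rw [← he, ContinuousLinearMap.inverse_equiv, sub_eq_zero, ← eq_sub_iff_add_eq]
  exact (ContinuousLinearEquiv.eq_symm_apply e).symm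

set_option maxSynthPendingDepth 2 in
theorem contDiffAt_magneticAcceleration [CompleteSpace V] {G S : V → V →L[ℝ] V →L[ℝ] ℝ} {p : V × V}
    (hG : ContDiffAt ℝ ∞ G p.1) (hS : ContDiffAt ℝ ∞ S p.1) (h : (G p.1).IsInvertible) :
    ContDiffAt ℝ ∞ (magneticAcceleration G S) p := by
  have c1 : ContDiffAt ℝ ∞ (fun p : V × V => G p.1) p := hG.comp p contDiffAt_fst
  have c2 : ContDiffAt ℝ ∞ (fun p : V × V => S p.1) p := hS.comp p contDiffAt_fst
  have c3 : ContDiffAt ℝ ∞ (fun p : V × V => fderiv ℝ G p.1) p :=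
    (hG.fderiv_right (m := ∞) (by simp)).comp p contDiffAt_fst
  have c4 : ContDiffAt ℝ ∞ (fun p : V × V => (G p.1).inverse) p :=
    ContDiffAt.comp p (g := ContinuousLinearMap.inverse) h.contDiffAt_map_inverse c1
  have c5 : ContDiffAt ℝ ∞ (fun p : V × V => fderiv ℝ G p.1 p.2 p.2) p :=
    (c3.clm_apply contDiffAt_snd).clm_apply contDiffAt_snd
  have c6 : ContDiffAt ℝ ∞ (fun p : V × V => (fderiv ℝ G p.1).flip p.2) p :=
    ContDiffAt.clm_apply (f := fun p : V × V =>
      ContinuousLinearMap.flipₗᵢ ℝ V V (V →L[ℝ] ℝ) (fderiv ℝ G p.1))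
      ((LinearIsometryEquiv.contDiff _).contDiffAt.comp p c3) contDiffAt_snd
  have c7 : ContDiffAt ℝ ∞ (fun p : V × V => ((fderiv ℝ G p.1).flip p.2).flip p.2) p :=
    ContDiffAt.clm_apply (f := fun p : V × V =>
      ContinuousLinearMap.flipₗᵢ ℝ V V ℝ ((fderiv ℝ G p.1).flip p.2))
      ((LinearIsometryEquiv.contDiff _).contDiffAt.comp p c6) contDiffAt_snd
  exact c4.clm_apply ((c2.clm_apply contDiffAt_snd).sub
    (((c5.add c5).sub c7).const_smul (1 / 2 : ℝ)))

/-- Smoothness of integral curves of smooth vector fields. -/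
theorem contDiffOn_of_hasDerivAt {f : V → V} {U : Set V} (hf : ContDiffOn ℝ ∞ f U)
    {a b : ℝ} {α : ℝ → V} (hα : ∀ t ∈ Ioo a b, HasDerivAt α (f (α t)) t)
    (hm : MapsTo α (Ioo a b) U) : ContDiffOn ℝ ∞ α (Ioo a b) := by
  -- Bootstrap: the derivative `f ∘ α` is as regular as `α`, so each induction step gains one
  -- derivative.
  rw [contDiffOn_infty]
  intro n
  induction n with
  | zero =>
    exact contDiffOn_zero.2 (fun t ht => (hα t ht).continuousAt.continuousWithinAt)
  | succ n ih =>
    have := (contDiffOn_succ_iff_deriv_of_isOpen (𝕜 := ℝ) (f := α) (n := n) isOpen_Ioo).2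
      ⟨fun t ht => (hα t ht).differentiableAt.differentiableWithinAt, by simp,
        (((hf.of_le (by exact_mod_cast le_top)).comp ih hm).congr fun t ht => (hα t ht).deriv)⟩
    exact_mod_cast this

/-- Picard–Lindelöf for the first-order system `(x, u)' = (u, magneticAcceleration (x, u))` on phase
space. -/
theorem exists_magneticDefect_eq_zero [CompleteSpace V] {G S : V → V →L[ℝ] V →L[ℝ] ℝ} {T : Set V}
    (hT : IsOpen T) (hG : ContDiffOn ℝ ∞ G T) (hS : ContDiffOn ℝ ∞ S T)
    (h : ∀ y ∈ T, (G y).IsInvertible) {x₀ : V} (hx₀ : x₀ ∈ T) (u₀ : V) :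
    ∃ (x : ℝ → V) (ε : ℝ), 0 < ε ∧ x 0 = x₀ ∧ deriv x 0 = u₀ ∧ ContDiffOn ℝ ∞ x (Ioo (-ε) ε) ∧
      MapsTo x (Ioo (-ε) ε) T ∧ ∀ t ∈ Ioo (-ε) ε, magneticDefect G S x t = 0 := by
  let X : V × V → V × V := fun p => (p.2, magneticAcceleration G S p)
  have hX : ∀ p : V × V, p.1 ∈ T → ContDiffAt ℝ ∞ X p := fun p hp =>
    contDiffAt_snd.prodMk (contDiffAt_magneticAcceleration (hG.contDiffAt (hT.mem_nhds hp))
      (hS.contDiffAt (hT.mem_nhds hp)) (h _ hp))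
  obtain ⟨α, hα0, ε, hε, hα⟩ :=
    ((hX (x₀, u₀) hx₀).of_le (by exact_mod_cast le_top)
      : ContDiffAt ℝ 1 X _).exists_forall_mem_closedBall_exists_eq_forall_mem_Ioo_hasDerivAt₀ 0
  have hU : IsOpen (Prod.fst ⁻¹' T : Set (V × V)) := hT.preimage continuous_fst
  have hcont : ContinuousAt α 0 := (hα 0 (by simp [hε])).continuousAt
  -- The integral curve might leave the region over `T`, where the field is smooth; the time
  -- interval is shrunk to prevent this.
  have hev : ∀ᶠ t in 𝓝 (0 : ℝ), α t ∈ (Prod.fst ⁻¹' T : Set (V × V)) :=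
    hcont.eventually (hU.mem_nhds (by rw [hα0]; exact hx₀))
  obtain ⟨δ, hδ, hδ'⟩ := Metric.eventually_nhds_iff_ball.1 hev
  rw [Real.ball_eq_Ioo, zero_sub, zero_add] at hδ'
  rw [zero_sub, zero_add] at hα
  have hsub1 : Ioo (-(min ε δ)) (min ε δ) ⊆ Ioo (-ε) ε :=
    Ioo_subset_Ioo (neg_le_neg (min_le_left _ _)) (min_le_left _ _)
  have hsub2 : Ioo (-(min ε δ)) (min ε δ) ⊆ Ioo (-δ) δ :=
    Ioo_subset_Ioo (neg_le_neg (min_le_right _ _)) (min_le_right _ _)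
  have hmin : 0 < min ε δ := lt_min hε hδ
  have hmaps : MapsTo α (Ioo (-(min ε δ)) (min ε δ)) (Prod.fst ⁻¹' T) :=
    fun t ht => hδ' t (hsub2 ht)
  have d1 : ∀ t ∈ Ioo (-(min ε δ)) (min ε δ), HasDerivAt (fun t => (α t).1) (α t).2 t :=
    fun t ht => (hasFDerivAt_fst (𝕜 := ℝ) (p := α t)).comp_hasDerivAt t (hα t (hsub1 ht))
  have d2 : ∀ t ∈ Ioo (-(min ε δ)) (min ε δ),
      HasDerivAt (fun t => (α t).2) (magneticAcceleration G S (α t)) t :=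
    fun t ht => (hasFDerivAt_snd (𝕜 := ℝ) (p := α t)).comp_hasDerivAt t (hα t (hsub1 ht))
  have h0 : (0 : ℝ) ∈ Ioo (-(min ε δ)) (min ε δ) := ⟨by linarith, hmin⟩
  refine ⟨fun t => (α t).1, min ε δ, hmin, by simp [hα0], by rw [(d1 0 h0).deriv, hα0], ?_,
    hmaps, fun t ht => ?_⟩
  · exact contDiff_fst.comp_contDiffOn (contDiffOn_of_hasDerivAt
      (fun p hp => (hX p hp).contDiffWithinAt) (fun t ht => hα t (hsub1 ht)) hmaps)
  · have hdd : deriv (fun t => (α t).1) =ᶠ[𝓝 t] fun t => (α t).2 := by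
      filter_upwards [isOpen_Ioo.mem_nhds ht] with s hs using (d1 s hs).deriv
    rw [magneticDefect_eq_zero_iff (h _ (hmaps ht)), hdd.deriv_eq, (d2 t ht).deriv, (d1 t ht).deriv]

/-- The phase curves `(x, ẋ)` and `(y, ẏ)` solve the same first-order system, whose field is
Lipschitz near the common initial value. -/
theorem eventuallyEq_of_magneticDefect_eq_zero [CompleteSpace V] {G S : V → V →L[ℝ] V →L[ℝ] ℝ}
    {T : Set V}
    (hT : IsOpen T) (hG : ContDiffOn ℝ ∞ G T) (hS : ContDiffOn ℝ ∞ S T)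
    (h : ∀ y ∈ T, (G y).IsInvertible) {x y : ℝ → V} {t₀ : ℝ} (hx : ContDiffAt ℝ 2 x t₀)
    (hy : ContDiffAt ℝ 2 y t₀) (hxT : x t₀ ∈ T) (hxy : x t₀ = y t₀)
    (hxy' : deriv x t₀ = deriv y t₀) (hx0 : ∀ᶠ t in 𝓝 t₀, magneticDefect G S x t = 0)
    (hy0 : ∀ᶠ t in 𝓝 t₀, magneticDefect G S y t = 0) : x =ᶠ[𝓝 t₀] y := by
  let X : V × V → V × V := fun p => (p.2, magneticAcceleration G S p)
  have hX : ContDiffAt ℝ 1 X (x t₀, deriv x t₀) :=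
    contDiffAt_snd.prodMk ((contDiffAt_magneticAcceleration (hG.contDiffAt (hT.mem_nhds hxT))
      (hS.contDiffAt (hT.mem_nhds hxT)) (h _ hxT)).of_le (by exact_mod_cast le_top))
  obtain ⟨K, s, hs, hK⟩ := hX.exists_lipschitzOnWith
  have key : ∀ z : ℝ → V, ContDiffAt ℝ 2 z t₀ → z t₀ = x t₀ → deriv z t₀ = deriv x t₀ →
      (∀ᶠ t in 𝓝 t₀, magneticDefect G S z t = 0) →
      ∀ᶠ t in 𝓝 t₀, HasDerivAt (fun t => (z t, deriv z t)) (X (z t, deriv z t)) t ∧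
        (z t, deriv z t) ∈ s := by
    intro z hz hz1 hz2 hz0
    have c : ContinuousAt (fun t => (z t, deriv z t)) t₀ :=
      hz.continuousAt.prodMk (hz.derivWithin (m := 1) (by norm_num)).continuousAt
    have hzT : ∀ᶠ t in 𝓝 t₀, z t ∈ T :=
      hz.continuousAt.eventually (hT.mem_nhds (by rw [hz1]; exact hxT))
    have hzs : ∀ᶠ t in 𝓝 t₀, (z t, deriv z t) ∈ s := by
      refine c.eventually ?_
      change s ∈ 𝓝 (z t₀, deriv z t₀)
      rw [hz1, hz2]; exact hs
    filter_upwards [hz0, hzT, hzs, hz.eventually (by simp)] with t h1 h2 h3 h4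
    refine ⟨?_, h3⟩
    have e := (magneticDefect_eq_zero_iff (h _ h2)).1 h1
    have d2 : HasDerivAt (deriv z) (deriv (deriv z) t) t :=
      ((h4.derivWithin (m := 1) (by norm_num)).differentiableAt one_ne_zero).hasDerivAt
    rw [e] at d2
    exact (h4.differentiableAt two_ne_zero).hasDerivAt.prodMk d2
  have := ODE_solution_unique_of_eventually (v := fun _ => X) (s := fun _ => s)
    (Eventually.of_forall fun _ => hK) (key x hx rfl rfl hx0) (key y hy hxy.symm hxy'.symm hy0)
    (by simp [hxy, hxy'])
  filter_upwards [this] with t ht using congrArg Prod.fst ht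

end Ode

/-! ### Tensors and maps in the preferred charts. -/

section Coordinates

variable {E : Type*} [NormedAddCommGroup E] [NormedSpace ℝ E]
  {M : Type*} [TopologicalSpace M] [ChartedSpace E M] [IsManifold 𝓘(ℝ, E) ∞ M]
  {F : Type*} [NormedAddCommGroup F] [NormedSpace ℝ F]
  {N : Type*} [TopologicalSpace N] [ChartedSpace F N] [IsManifold 𝓘(ℝ, F) ∞ N]

theorem mem_baseSet_of_mem_source {q x : M}
    (hx : x ∈ (extChartAt 𝓘(ℝ, E) q).source) :
    x ∈ (trivializationAt E (TangentSpace 𝓘(ℝ, E) : M → Type _) q).baseSet := by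
  simpa using hx

theorem coord_eq_continuousLinearMapAt {q x : M} (hx : x ∈ (extChartAt 𝓘(ℝ, E) q).source)
    (w : TangentSpace 𝓘(ℝ, E) x) :
    coord q x w = (trivializationAt E (TangentSpace 𝓘(ℝ, E) : M → Type _) q).continuousLinearMapAt
      ℝ x w := by
  rw [Bundle.Trivialization.continuousLinearMapAt_apply,
    Bundle.Trivialization.linearMapAt_apply, if_pos (mem_baseSet_of_mem_source hx)]
  rfl

theorem coord_eq_mfderiv {q x : M} (hx : x ∈ (extChartAt 𝓘(ℝ, E) q).source)
    (w : TangentSpace 𝓘(ℝ, E) x) :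
    coord q x w = mfderiv 𝓘(ℝ, E) 𝓘(ℝ, E) (extChartAt 𝓘(ℝ, E) q) x w := by
  rw [coord_eq_continuousLinearMapAt hx,
    TangentBundle.continuousLinearMapAt_trivializationAt (by simpa using hx)]
  rfl

theorem coord_ofCoord {q x : M} (hx : x ∈ (extChartAt 𝓘(ℝ, E) q).source) (e : E) :
    coord q x (ofCoord q x e) = e := by
  rw [coord_eq_continuousLinearMapAt hx]
  exact Bundle.Trivialization.continuousLinearMapAt_symmL _ (mem_baseSet_of_mem_source hx) e

theorem ofCoord_coord {q x : M} (hx : x ∈ (extChartAt 𝓘(ℝ, E) q).source)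
    (w : TangentSpace 𝓘(ℝ, E) x) : ofCoord q x (coord q x w) = w := by
  rw [coord_eq_continuousLinearMapAt hx]
  exact Bundle.Trivialization.symmL_continuousLinearMapAt _ (mem_baseSet_of_mem_source hx) w

/-- The fibre `T_q M` is by definition `E`, read in the preferred chart at `q`, so the coordinate
change at the centre is the identity. This lets the pointwise definitions, all made in the chart
centred at the point, be computed directly in `E`. -/
theorem ofCoord_self (q : M) (e : E) : ofCoord q q e = (e : TangentSpace 𝓘(ℝ, E) q) := by
  have h := TangentBundle.symmL_trivializationAt_eq_core (I := 𝓘(ℝ, E)) (b₀ := q) (b := q)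
    (mem_chart_source E q)
  have h' := congrArg (fun l : E →L[ℝ] E => l e) h
  exact h'.trans ((tangentBundleCore 𝓘(ℝ, E) M).coordChange_self (achart E q) q
    (mem_chart_source E q) e)

theorem coord_self (q : M) (w : TangentSpace 𝓘(ℝ, E) q) : coord q q w = w := by
  conv_rhs => rw [← ofCoord_coord (mem_extChartAt_source (I := 𝓘(ℝ, E)) q) w]
  exact (ofCoord_self q _).symm

theorem inChart_extChartAt (B : TwoTensor E M) {q x : M}
    (hx : x ∈ (extChartAt 𝓘(ℝ, E) q).source) :
    inChart B q (extChartAt 𝓘(ℝ, E) q x) = bilinPullback (B x) (ofCoord q x) :=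
  congrArg (fun z => bilinPullback (B z) (ofCoord q z)) ((extChartAt 𝓘(ℝ, E) q).left_inv hx)

theorem inChart_self (B : TwoTensor E M) (q : M) :
    inChart B q (extChartAt 𝓘(ℝ, E) q q) = B q := by
  rw [inChart_extChartAt B (mem_extChartAt_source q)]
  ext u v
  rw [bilinPullback_apply, ofCoord_self, ofCoord_self]
  rfl

variable (E F) in
/-- The coordinate expression of a map `f` in the preferred charts around `p` and `q`. -/
def mapInChart (f : N → M) (p : N) (q : M) : F → E :=
  extChartAt 𝓘(ℝ, E) q ∘ f ∘ (extChartAt 𝓘(ℝ, F) p).symm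

theorem contDiffAt_mapInChart {n : ℕ∞ω} {f : N → M} {p x : N} {q : M} (hn : n ≤ ∞)
    (hf : ContMDiffAt 𝓘(ℝ, F) 𝓘(ℝ, E) n f x)
    (hx : x ∈ (extChartAt 𝓘(ℝ, F) p).source) (hfx : f x ∈ (extChartAt 𝓘(ℝ, E) q).source) :
    ContDiffAt ℝ n (mapInChart E F f p q) (extChartAt 𝓘(ℝ, F) p x) := by
  have : IsManifold 𝓘(ℝ, F) n N := IsManifold.of_le hn
  have : IsManifold 𝓘(ℝ, E) n M := IsManifold.of_le hn
  have := ((contMDiffAt_iff_of_mem_source (x := p) (y := q) (by simpa using hx)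
    (by simpa using hfx)).1 hf).2
  simpa [contDiffWithinAt_univ] using! this

omit [IsManifold 𝓘(ℝ, E) ∞ M] [IsManifold 𝓘(ℝ, F) ∞ N] in
theorem mapInChart_comp_eventuallyEq {f : N → M} {p x : N} (q : M)
    (hx : x ∈ (extChartAt 𝓘(ℝ, F) p).source) :
    mapInChart E F f p q ∘ extChartAt 𝓘(ℝ, F) p =ᶠ[𝓝 x] extChartAt 𝓘(ℝ, E) q ∘ f := by
  filter_upwards [(isOpen_extChartAt_source (I := 𝓘(ℝ, F)) p).mem_nhds hx] with z hz
  simp only [mapInChart, Function.comp_apply]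
  rw [(extChartAt 𝓘(ℝ, F) p).left_inv hz]

theorem mdifferentiableAt_extChartAt_of_mem {q x : M}
    (hx : x ∈ (extChartAt 𝓘(ℝ, E) q).source) :
    MDifferentiableAt 𝓘(ℝ, E) 𝓘(ℝ, E) (extChartAt 𝓘(ℝ, E) q) x :=
  mdifferentiableAt_extChartAt (by simpa using hx)

/-- Both sides are the differential at `x` of one map, factored as `mapInChart ∘ chart` and as
`chart ∘ f`. -/
theorem fderiv_mapInChart_coord {f : N → M} {p x : N} {q : M}
    (hf : ContMDiffAt 𝓘(ℝ, F) 𝓘(ℝ, E) 1 f x)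
    (hx : x ∈ (extChartAt 𝓘(ℝ, F) p).source) (hfx : f x ∈ (extChartAt 𝓘(ℝ, E) q).source)
    (w : TangentSpace 𝓘(ℝ, F) x) :
    fderiv ℝ (mapInChart E F f p q) (extChartAt 𝓘(ℝ, F) p x) (coord p x w)
      = coord q (f x) (mfderiv 𝓘(ℝ, F) 𝓘(ℝ, E) f x w) := by
  have d := (contDiffAt_mapInChart (E := E) (F := F) (by exact_mod_cast le_top) hf hx hfx).differentiableAt
    one_ne_zero
  have h1 := mfderiv_comp x (I := 𝓘(ℝ, F)) (I' := 𝓘(ℝ, F)) (I'' := 𝓘(ℝ, E))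
    d.mdifferentiableAt (mdifferentiableAt_extChartAt_of_mem hx)
  have h2 := mfderiv_comp x (I := 𝓘(ℝ, F)) (I' := 𝓘(ℝ, E)) (I'' := 𝓘(ℝ, E))
    (mdifferentiableAt_extChartAt_of_mem hfx) (hf.mdifferentiableAt one_ne_zero)
  have h3 := (mapInChart_comp_eventuallyEq (E := E) (F := F) (f := f) q hx).mfderiv_eq
    (I := 𝓘(ℝ, F)) (I' := 𝓘(ℝ, E))
  rw [coord_eq_mfderiv hx, coord_eq_mfderiv hfx, ← mfderiv_eq_fderiv]
  have h4 := (h1.symm.trans h3).trans h2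
  exact congrArg (fun l : F →L[ℝ] E => l w) h4

theorem fderiv_mapInChart {f : N → M} {p x : N} {q : M}
    (hf : ContMDiffAt 𝓘(ℝ, F) 𝓘(ℝ, E) 1 f x)
    (hx : x ∈ (extChartAt 𝓘(ℝ, F) p).source) (hfx : f x ∈ (extChartAt 𝓘(ℝ, E) q).source) (u : F) :
    fderiv ℝ (mapInChart E F f p q) (extChartAt 𝓘(ℝ, F) p x) u
      = coord q (f x) (mfderiv 𝓘(ℝ, F) 𝓘(ℝ, E) f x (ofCoord p x u)) := by
  rw [← fderiv_mapInChart_coord hf hx hfx, coord_ofCoord hx]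

theorem inChart_pullbackTensor (B : TwoTensor E M) {f : N → M} {p x : N} {q : M}
    (hf : ContMDiffAt 𝓘(ℝ, F) 𝓘(ℝ, E) 1 f x)
    (hx : x ∈ (extChartAt 𝓘(ℝ, F) p).source) (hfx : f x ∈ (extChartAt 𝓘(ℝ, E) q).source) :
    inChart (pullbackTensor (F := F) f B) p (extChartAt 𝓘(ℝ, F) p x) =
      bilinPullback (inChart B q (mapInChart E F f p q (extChartAt 𝓘(ℝ, F) p x)))
        (fderiv ℝ (mapInChart E F f p q) (extChartAt 𝓘(ℝ, F) p x)) := by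
  have h : mapInChart E F f p q (extChartAt 𝓘(ℝ, F) p x) = extChartAt 𝓘(ℝ, E) q (f x) :=
    (mapInChart_comp_eventuallyEq (f := f) q hx).self_of_nhds
  rw [inChart_extChartAt _ hx, h, inChart_extChartAt _ hfx]
  ext u v
  simp only [bilinPullback_apply, pullbackTensor]
  rw [fderiv_mapInChart hf hx hfx, fderiv_mapInChart hf hx hfx, ofCoord_coord hfx,
    ofCoord_coord hfx]

/-- Christoffel symbols differentiate the metric, so `magneticDefect_pullback` needs the pullback
identity on a neighbourhood and not just at one point. -/
theorem inChart_pullbackTensor_eventuallyEq (B : TwoTensor E M) {f : N → M} {p x : N} {q : M}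
    (hf : ContMDiffAt 𝓘(ℝ, F) 𝓘(ℝ, E) 1 f x)
    (hx : x ∈ (extChartAt 𝓘(ℝ, F) p).source) (hfx : f x ∈ (extChartAt 𝓘(ℝ, E) q).source) :
    inChart (pullbackTensor (F := F) f B) p =ᶠ[𝓝 (extChartAt 𝓘(ℝ, F) p x)] fun y =>
      bilinPullback (inChart B q (mapInChart E F f p q y)) (fderiv ℝ (mapInChart E F f p q) y) := by
  have h1 : ∀ᶠ z in 𝓝 x, ContMDiffAt 𝓘(ℝ, F) 𝓘(ℝ, E) 1 f z := (contMDiffAt_iff_contMDiffAt_nhds (by simp)).1 hf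
  have h2 : ∀ᶠ z in 𝓝 x, f z ∈ (extChartAt 𝓘(ℝ, E) q).source :=
    hf.continuousAt.eventually ((isOpen_extChartAt_source (I := 𝓘(ℝ, E)) q).mem_nhds hfx)
  have h3 : Tendsto (extChartAt 𝓘(ℝ, F) p).symm (𝓝 (extChartAt 𝓘(ℝ, F) p x)) (𝓝 x) := by
    have := continuousAt_extChartAt_symm' (I := 𝓘(ℝ, F)) hx
    rwa [ContinuousAt, (extChartAt 𝓘(ℝ, F) p).left_inv hx] at this
  have h4 : (extChartAt 𝓘(ℝ, F) p).target ∈ 𝓝 (extChartAt 𝓘(ℝ, F) p x) :=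
    extChartAt_target_mem_nhds' ((extChartAt 𝓘(ℝ, F) p).map_source hx)
  filter_upwards [h3.eventually (h1.and h2), h4] with y hy hyt
  have := inChart_pullbackTensor B hy.1 ((extChartAt 𝓘(ℝ, F) p).map_target hyt) hy.2
  rwa [(extChartAt 𝓘(ℝ, F) p).right_inv hyt] at this

omit [IsManifold 𝓘(ℝ, E) ∞ M] in
theorem pullbackTensor_id (B : TwoTensor E M) : pullbackTensor (fun x : M => x) B = B := by
  funext x
  ext u v
  have h : mfderiv 𝓘(ℝ, E) 𝓘(ℝ, E) (fun x : M => x) x = ContinuousLinearMap.id ℝ _ := mfderiv_id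
  simp only [pullbackTensor, bilinPullback_apply, h]
  rfl

/-- A field of bilinear forms is smooth if its coordinate expressions in the preferred charts
are. -/
def IsSmoothTensor (B : TwoTensor E M) : Prop :=
  ∀ q : M, ContDiffOn ℝ ∞ (inChart B q) (extChartAt 𝓘(ℝ, E) q).target

theorem IsSmoothTensor.contDiffAt {B : TwoTensor E M} (hB : IsSmoothTensor B) {q x : M}
    (hx : x ∈ (extChartAt 𝓘(ℝ, E) q).source) :
    ContDiffAt ℝ ∞ (inChart B q) (extChartAt 𝓘(ℝ, E) q x) :=
  (hB q).contDiffAt (extChartAt_target_mem_nhds' ((extChartAt 𝓘(ℝ, E) q).map_source hx))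

theorem IsSmoothTensor.pullbackTensor {B : TwoTensor E M} (hB : IsSmoothTensor B) {f : N → M}
    (hf : ContMDiff 𝓘(ℝ, F) 𝓘(ℝ, E) ∞ f) : IsSmoothTensor (pullbackTensor (F := F) f B) := by
  intro p y hy
  obtain ⟨x, hx, rfl⟩ : ∃ x ∈ (extChartAt 𝓘(ℝ, F) p).source, extChartAt 𝓘(ℝ, F) p x = y :=
    ⟨_, (extChartAt 𝓘(ℝ, F) p).map_target hy, (extChartAt 𝓘(ℝ, F) p).right_inv hy⟩
  have hfx := mem_extChartAt_source (I := 𝓘(ℝ, E)) (f x)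
  have h := inChart_pullbackTensor_eventuallyEq B
    ((hf x).of_le (by exact_mod_cast le_top)) hx hfx
  have d := contDiffAt_mapInChart le_rfl (hf x) hx hfx
  have e : mapInChart E F f p (f x) (extChartAt 𝓘(ℝ, F) p x) = extChartAt 𝓘(ℝ, E) (f x) (f x) :=
    (mapInChart_comp_eventuallyEq (f := f) (f x) hx).self_of_nhds
  refine ContDiffAt.contDiffWithinAt (ContDiffAt.congr_of_eventuallyEq ?_ h)
  refine contDiffAt_bilinPullback (ContDiffAt.comp (g := inChart B (f x)) _ ?_ d) (d.fderiv_right (by simp))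
  rw [e]
  exact hB.contDiffAt hfx

/-- In finite dimension it suffices to test the coordinate expression on fixed vectors `u`, `v`,
that is, to evaluate `B` on the smooth local sections with constant coordinates. -/
theorem isSmoothTensor_of_contMDiff [FiniteDimensional ℝ E] {B : TwoTensor E M}
    (hB : ContMDiff 𝓘(ℝ, E) (𝓘(ℝ, E).prod 𝓘(ℝ, E →L[ℝ] E →L[ℝ] ℝ)) ∞
      (fun x => Bundle.TotalSpace.mk' (E →L[ℝ] E →L[ℝ] ℝ)
        (E := fun x : M => TangentSpace 𝓘(ℝ, E) x →L[ℝ] TangentSpace 𝓘(ℝ, E) x →L[ℝ] ℝ)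
        x (B x))) : IsSmoothTensor B := by
  intro q
  have hsec : ∀ u : E, ContMDiffOn 𝓘(ℝ, E) (𝓘(ℝ, E).prod 𝓘(ℝ, E)) ∞
      (fun x => Bundle.TotalSpace.mk' E (E := (TangentSpace 𝓘(ℝ, E) : M → Type _)) x
        (ofCoord q x u)) (extChartAt 𝓘(ℝ, E) q).source := by
    intro u x hx
    exact (((trivializationAt E (TangentSpace 𝓘(ℝ, E) : M → Type _) q).contMDiffAt_symmL
      (n := ∞) (IB := 𝓘(ℝ, E)) (mem_baseSet_of_mem_source hx)).clm_bundle_apply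
      (F₁ := E) (E₁ := Bundle.Trivial M E) (b := fun x : M => x) (v := fun _ => u)
      ((Bundle.contMDiffAt_section x).2 contMDiffAt_const)).contMDiffWithinAt
  rw [contDiffOn_clm_apply]
  intro u
  rw [contDiffOn_clm_apply]
  intro v
  have h : ContMDiffOn 𝓘(ℝ, E) 𝓘(ℝ, ℝ) ∞ (fun x => B x (ofCoord q x u) (ofCoord q x v))
      (extChartAt 𝓘(ℝ, E) q).source := by
    intro x hx
    have h := ContMDiffWithinAt.clm_bundle_apply₂ (n := ∞) (F₃ := ℝ) (E₃ := Bundle.Trivial M ℝ)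
      (b := fun x : M => x) (hB x).contMDiffWithinAt (hsec u x hx) (hsec v x hx)
    rw [Bundle.contMDiffWithinAt_totalSpace] at h
    exact h.2
  have h2 := h.comp (contMDiffOn_extChartAt_symm q) (extChartAt 𝓘(ℝ, E) q).mapsTo_symm
  exact contMDiffOn_iff_contDiffOn.1 h2

end Coordinates

/-! ### Riemannian metrics and magnetic geodesics on manifolds. -/

section Curves

variable {E : Type*} [NormedAddCommGroup E] [NormedSpace ℝ E]
  {M : Type*} [TopologicalSpace M] [ChartedSpace E M] [IsManifold 𝓘(ℝ, E) ∞ M]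
  {F : Type*} [NormedAddCommGroup F] [NormedSpace ℝ F]
  {N : Type*} [TopologicalSpace N] [ChartedSpace F N] [IsManifold 𝓘(ℝ, F) ∞ N]

/-- A smooth Riemannian metric, as a field of bilinear forms. -/
structure IsRiemannianMetric (g : TwoTensor E M) : Prop where
  smooth : IsSmoothTensor g
  symm : ∀ (x : M) (u v : TangentSpace 𝓘(ℝ, E) x), g x u v = g x v u
  pos : ∀ (x : M) (v : TangentSpace 𝓘(ℝ, E) x), v ≠ 0 → 0 < g x v v

theorem IsRiemannianMetric.pullbackTensor {g : TwoTensor E M} (hg : IsRiemannianMetric g)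
    {f : N → M} (hf : ContMDiff 𝓘(ℝ, F) 𝓘(ℝ, E) ∞ f)
    (hinj : ∀ x, Function.Injective (mfderiv 𝓘(ℝ, F) 𝓘(ℝ, E) f x)) :
    IsRiemannianMetric (pullbackTensor (F := F) f g) where
  smooth := hg.smooth.pullbackTensor hf
  symm _ _ _ := hg.symm _ _ _
  pos x _ hv := hg.pos _ _ fun h => hv (hinj x (h.trans (map_zero _).symm))

theorem isInvertible_of_pos {V : Type*} [NormedAddCommGroup V] [NormedSpace ℝ V]
    [FiniteDimensional ℝ V] (B : V →L[ℝ] V →L[ℝ] ℝ) (hB : ∀ v, v ≠ 0 → 0 < B v v) :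
    B.IsInvertible := by
  have hinj : Function.Injective B.toLinearMap := by
    rw [← LinearMap.ker_eq_bot, LinearMap.ker_eq_bot']
    intro v hv
    by_contra hne
    have hv' : B v = 0 := hv
    have := hB v hne
    simp [hv'] at this
  have hrank : Module.finrank ℝ V = Module.finrank ℝ (V →L[ℝ] ℝ) := by
    rw [← (LinearMap.toContinuousLinearMap (𝕜 := ℝ) (E := V) (F' := ℝ)).finrank_eq]
    exact Subspace.dual_finrank_eq.symm
  refine ⟨(LinearEquiv.ofInjectiveOfFinrankEq B.toLinearMap hinj hrank).toContinuousLinearEquiv, ?_⟩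
  ext u v
  rfl

theorem IsRiemannianMetric.isInvertible [FiniteDimensional ℝ E] {g : TwoTensor E M}
    (hg : IsRiemannianMetric g) (q : M) :
    ∀ y ∈ (extChartAt 𝓘(ℝ, E) q).target, (inChart g q y).IsInvertible := by
  intro y hy
  refine isInvertible_of_pos _ fun v hv => hg.pos _ _ fun h => hv ?_
  have hy' := (extChartAt 𝓘(ℝ, E) q).map_target hy
  rw [← coord_ofCoord hy' v]
  refine (congrArg (coord q _) h).trans ?_
  rw [coord_eq_continuousLinearMapAt hy', map_zero]

/-! ### Curves in charts -/

theorem contDiffAt_extChartAt_comp {n : ℕ∞ω} (hn : n ≤ ∞) {γ : ℝ → M} {t : ℝ} {q : M}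
    (hγ : ContMDiffAt 𝓘(ℝ, ℝ) 𝓘(ℝ, E) n γ t) (hq : γ t ∈ (extChartAt 𝓘(ℝ, E) q).source) :
    ContDiffAt ℝ n (extChartAt 𝓘(ℝ, E) q ∘ γ) t := by
  have : IsManifold 𝓘(ℝ, E) n M := IsManifold.of_le hn
  exact contMDiffAt_iff_contDiffAt.1
    ((contMDiffAt_extChartAt' (by simpa using hq)).comp t hγ)

theorem coord_velocity {γ : ℝ → M} {t : ℝ} {q : M}
    (hγ : MDifferentiableAt 𝓘(ℝ, ℝ) 𝓘(ℝ, E) γ t) (hq : γ t ∈ (extChartAt 𝓘(ℝ, E) q).source) :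
    coord q (γ t) (velocity (E := E) γ t) = deriv (extChartAt 𝓘(ℝ, E) q ∘ γ) t := by
  have h := mfderiv_comp t (I := 𝓘(ℝ, ℝ)) (I' := 𝓘(ℝ, E)) (I'' := 𝓘(ℝ, E))
    (mdifferentiableAt_extChartAt_of_mem hq) hγ
  rw [mfderiv_eq_fderiv] at h
  rw [coord_eq_mfderiv hq]
  exact (congrArg (fun l : ℝ →L[ℝ] E => l 1) h).symm

omit [IsManifold 𝓘(ℝ, E) ∞ M] in
theorem eventually_mem_extChartAt_source {γ : ℝ → M} {t : ℝ} {q : M} (hγ : ContinuousAt γ t)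
    (hq : γ t ∈ (extChartAt 𝓘(ℝ, E) q).source) :
    ∀ᶠ s in 𝓝 t, γ s ∈ (extChartAt 𝓘(ℝ, E) q).source :=
  hγ.eventually ((isOpen_extChartAt_source (I := 𝓘(ℝ, E)) q).mem_nhds hq)

theorem coord_velocity_eventuallyEq {γ : ℝ → M} {t : ℝ} {q : M}
    (hγ : ContMDiffAt 𝓘(ℝ, ℝ) 𝓘(ℝ, E) 1 γ t) (hq : γ t ∈ (extChartAt 𝓘(ℝ, E) q).source) :
    (fun s => coord q (γ s) (velocity (E := E) γ s)) =ᶠ[𝓝 t]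
      deriv (extChartAt 𝓘(ℝ, E) q ∘ γ) := by
  filter_upwards [(contMDiffAt_iff_contMDiffAt_nhds (by simp)).1 hγ,
    eventually_mem_extChartAt_source hγ.continuousAt hq] with s hs hs'
  exact coord_velocity (hs.mdifferentiableAt one_ne_zero) hs'

theorem covDerivAlong_velocity (g : TwoTensor E M) {γ : ℝ → M} {t : ℝ}
    (hγ : ContMDiffAt 𝓘(ℝ, ℝ) 𝓘(ℝ, E) 1 γ t) :
    covDerivAlong (F := ℝ) (N := ℝ) g γ (fun s => velocity γ s) t (1 : ℝ) =
      (deriv (deriv (extChartAt 𝓘(ℝ, E) (γ t) ∘ γ)) t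
        + christoffel g (γ t) (deriv (extChartAt 𝓘(ℝ, E) (γ t) ∘ γ) t)
          (deriv (extChartAt 𝓘(ℝ, E) (γ t) ∘ γ) t) : E) := by
  have hq := mem_extChartAt_source (I := 𝓘(ℝ, E)) (γ t)
  have h1 := coord_velocity_eventuallyEq hγ hq
  have h2 : coord (γ t) (γ t) (velocity (E := E) γ t) =
    deriv (extChartAt 𝓘(ℝ, E) (γ t) ∘ γ) t := h1.self_of_nhds
  refine (ofCoord_self (γ t) _).trans ?_
  have h3 : mvfderiv 𝓘(ℝ, ℝ) (fun s => coord (γ t) (γ s) (velocity (E := E) γ s)) t (1 : ℝ) =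
      deriv (deriv (extChartAt 𝓘(ℝ, E) (γ t) ∘ γ)) t := by
    rw [← h1.deriv_eq, mvfderiv, mfderiv_eq_fderiv]
    rfl
  rw [h3, h2]
  have h4 : coord (γ t) (γ t) (mfderiv 𝓘(ℝ, ℝ) 𝓘(ℝ, E) γ t (1 : ℝ)) =
    deriv (extChartAt 𝓘(ℝ, E) (γ t) ∘ γ) t := h2
  rw [h4]

/-- `covDerivAlong` and `lorentzForce` unfold to coordinate formulas only in the chart centred at `γ
t`; there the equation is raised or lowered by the invertible metric. -/
theorem magneticEquation_iff_magneticDefect_self {g σ : TwoTensor E M} {γ : ℝ → M} {t : ℝ}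
    (hγ : ContMDiffAt 𝓘(ℝ, ℝ) 𝓘(ℝ, E) 1 γ t)
    (hinv : (inChart g (γ t) (extChartAt 𝓘(ℝ, E) (γ t) (γ t))).IsInvertible) :
    covDerivAlong (F := ℝ) (N := ℝ) g γ (fun s => velocity γ s) t (1 : ℝ)
        = lorentzForce g σ (γ t) (velocity γ t) ↔
      magneticDefect (inChart g (γ t)) (inChart σ (γ t)) (extChartAt 𝓘(ℝ, E) (γ t) ∘ γ) t = 0 := by
  have hv : velocity (E := E) γ t = deriv (extChartAt 𝓘(ℝ, E) (γ t) ∘ γ) t := by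
    rw [← coord_velocity (hγ.mdifferentiableAt one_ne_zero) (mem_extChartAt_source (γ t)),
      coord_self]
  have hY : lorentzForce g σ (γ t) (velocity γ t) =
      (inChart g (γ t) (extChartAt 𝓘(ℝ, E) (γ t) (γ t))).inverse
        (inChart σ (γ t) (extChartAt 𝓘(ℝ, E) (γ t) (γ t))
          (deriv (extChartAt 𝓘(ℝ, E) (γ t) ∘ γ) t)) := by
    rw [inChart_self, inChart_self, lorentzForce, hv]
    rfl
  rw [magneticDefect_eq_zero_iff hinv, covDerivAlong_velocity g hγ, hY]
  simp only [magneticAcceleration, Function.comp_apply, map_sub]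
  exact eq_sub_iff_add_eq.symm

theorem magneticDefect_congr {V : Type*} [NormedAddCommGroup V] [NormedSpace ℝ V]
    (G S : V → V →L[ℝ] V →L[ℝ] ℝ) {x y : ℝ → V} {t : ℝ} (h : x =ᶠ[𝓝 t] y) :
    magneticDefect G S x t = magneticDefect G S y t := by
  simp only [magneticDefect]
  rw [h.deriv.deriv_eq, h.deriv_eq, h.self_of_nhds]

/-- Naturality of the lowered magnetic geodesic equation in charts. -/
theorem magneticDefect_pullbackTensor {g σ : TwoTensor E M} (hg : IsRiemannianMetric g)
    {f : N → M} (hf : ContMDiff 𝓘(ℝ, F) 𝓘(ℝ, E) ∞ f) {c : ℝ → N} {t : ℝ}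
    (hc : ContMDiffAt 𝓘(ℝ, ℝ) 𝓘(ℝ, F) 2 c t) {p : N} {q : M}
    (hp : c t ∈ (extChartAt 𝓘(ℝ, F) p).source) (hq : f (c t) ∈ (extChartAt 𝓘(ℝ, E) q).source)
    (w : F) :
    magneticDefect (inChart (pullbackTensor (F := F) f g) p)
        (inChart (pullbackTensor (F := F) f σ) p) (extChartAt 𝓘(ℝ, F) p ∘ c) t w =
      magneticDefect (inChart g q) (inChart σ q) (extChartAt 𝓘(ℝ, E) q ∘ f ∘ c) t
        (fderiv ℝ (mapInChart E F f p q) (extChartAt 𝓘(ℝ, F) p (c t)) w) := by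
  have hf1 : ContMDiffAt 𝓘(ℝ, F) 𝓘(ℝ, E) 1 f (c t) := (hf _).of_le (by exact_mod_cast le_top)
  have hle : (2 : ℕ∞ω) ≤ ∞ := ENat.LEInfty.out
  have e : mapInChart E F f p q (extChartAt 𝓘(ℝ, F) p (c t)) = extChartAt 𝓘(ℝ, E) q (f (c t)) :=
    (mapInChart_comp_eventuallyEq (f := f) q hp).self_of_nhds
  have ec : mapInChart E F f p q ∘ (extChartAt 𝓘(ℝ, F) p ∘ c) =ᶠ[𝓝 t]
      extChartAt 𝓘(ℝ, E) q ∘ f ∘ c :=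
    hc.continuousAt.eventually (mapInChart_comp_eventuallyEq (f := f) q hp)
  rw [← magneticDefect_congr _ _ ec]
  refine magneticDefect_pullback ?_ ((contDiffAt_mapInChart le_rfl (hf _) hp hq).of_le hle)
    (contDiffAt_extChartAt_comp hle hc hp) ?_ (inChart_pullbackTensor_eventuallyEq g hf1 hp hq)
    (inChart_pullbackTensor σ hf1 hp hq) w
  · rw [Function.comp_apply, e]
    exact (hg.smooth.contDiffAt hq).of_le (by exact_mod_cast le_top)
  · intro a b
    exact hg.symm _ _ _

/-- Naturality for the identity map of `M`, read in two different charts. -/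
theorem magneticDefect_eq_zero_of_chart {g σ : TwoTensor E M} (hg : IsRiemannianMetric g)
    {γ : ℝ → M} {t : ℝ} (hγ : ContMDiffAt 𝓘(ℝ, ℝ) 𝓘(ℝ, E) 2 γ t) {p q : M}
    (hp : γ t ∈ (extChartAt 𝓘(ℝ, E) p).source) (hq : γ t ∈ (extChartAt 𝓘(ℝ, E) q).source)
    (h : magneticDefect (inChart g q) (inChart σ q) (extChartAt 𝓘(ℝ, E) q ∘ γ) t = 0) :
    magneticDefect (inChart g p) (inChart σ p) (extChartAt 𝓘(ℝ, E) p ∘ γ) t = 0 := by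
  ext w
  have := magneticDefect_pullbackTensor (σ := σ) hg (contMDiff_id (I := 𝓘(ℝ, E)) (M := M)) hγ hp hq w
  have hid : ∀ B : TwoTensor E M, pullbackTensor (F := E) (id : M → M) B = B := pullbackTensor_id
  rw [hid, hid] at this
  rw [this]
  exact congrArg (fun l : E →L[ℝ] ℝ => l _) h

/-- The magnetic geodesic equation can be checked in any preferred chart. -/
theorem magneticEquation_iff [FiniteDimensional ℝ E] {g σ : TwoTensor E M}
    (hg : IsRiemannianMetric g) {γ : ℝ → M} {t : ℝ}
    (hγ : ContMDiffAt 𝓘(ℝ, ℝ) 𝓘(ℝ, E) 2 γ t) {p : M}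
    (hp : γ t ∈ (extChartAt 𝓘(ℝ, E) p).source) :
    covDerivAlong (F := ℝ) (N := ℝ) g γ (fun s => velocity γ s) t (1 : ℝ)
        = lorentzForce g σ (γ t) (velocity γ t) ↔
      magneticDefect (inChart g p) (inChart σ p) (extChartAt 𝓘(ℝ, E) p ∘ γ) t = 0 := by
  have hq := mem_extChartAt_source (I := 𝓘(ℝ, E)) (γ t)
  rw [magneticEquation_iff_magneticDefect_self (hγ.of_le (by norm_num))
    (hg.isInvertible _ _ ((extChartAt 𝓘(ℝ, E) (γ t)).map_source hq))]
  exact ⟨magneticDefect_eq_zero_of_chart hg hγ hp hq, magneticDefect_eq_zero_of_chart hg hγ hq hp⟩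

/-! ### Existence and uniqueness of magnetic geodesics -/

-- Velocities of two curves lie in fibres over different base points, so initial conditions are
-- compared in the total space of the tangent bundle.
omit [IsManifold 𝓘(ℝ, E) ∞ M] in
theorem mk_velocity_congr {γ c : ℝ → M} {t : ℝ} (h : γ =ᶠ[𝓝 t] c) :
    (⟨γ t, velocity γ t⟩ : TangentBundle 𝓘(ℝ, E) M) = ⟨c t, velocity c t⟩ := by
  rw [Bundle.TotalSpace.mk.injEq]
  refine ⟨h.self_of_nhds, heq_of_eq ?_⟩
  exact congrArg (fun l : ℝ →L[ℝ] E => l 1) h.mfderiv_eq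

theorem exists_isMagneticGeodesicOn [FiniteDimensional ℝ E] {g σ : TwoTensor E M}
    (hg : IsRiemannianMetric g) (hσ : IsSmoothTensor σ) (q : M) (v : TangentSpace 𝓘(ℝ, E) q) :
    ∃ (γ : ℝ → M) (ε : ℝ), 0 < ε ∧ IsMagneticGeodesicOn g σ γ (Ioo (-ε) ε) ∧
      (⟨γ 0, velocity γ 0⟩ : TangentBundle 𝓘(ℝ, E) M) = ⟨q, v⟩ := by
  have : CompleteSpace E := FiniteDimensional.complete ℝ E
  obtain ⟨x, ε, hε, hx0, hx1, hx, hxT, hdef⟩ := exists_magneticDefect_eq_zero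
    (isOpen_extChartAt_target (I := 𝓘(ℝ, E)) q) (hg.smooth q) (hσ q) (hg.isInvertible q)
    (mem_extChartAt_target (I := 𝓘(ℝ, E)) q) (v : E)
  have h0 : (0 : ℝ) ∈ Ioo (-ε) ε := ⟨by linarith, hε⟩
  have hsm : ContMDiffOn 𝓘(ℝ, ℝ) 𝓘(ℝ, E) ∞ ((extChartAt 𝓘(ℝ, E) q).symm ∘ x) (Ioo (-ε) ε) :=
    (contMDiffOn_extChartAt_symm q).comp (contMDiffOn_iff_contDiffOn.2 hx) hxT
  have hat : ∀ t ∈ Ioo (-ε) ε,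
      ContMDiffAt 𝓘(ℝ, ℝ) 𝓘(ℝ, E) ∞ ((extChartAt 𝓘(ℝ, E) q).symm ∘ x) t :=
    fun t ht => (hsm t ht).contMDiffAt (isOpen_Ioo.mem_nhds ht)
  have hsrc : ∀ t ∈ Ioo (-ε) ε,
      ((extChartAt 𝓘(ℝ, E) q).symm ∘ x) t ∈ (extChartAt 𝓘(ℝ, E) q).source :=
    fun t ht => (extChartAt 𝓘(ℝ, E) q).map_target (hxT ht)
  have hback : ∀ t ∈ Ioo (-ε) ε,
      extChartAt 𝓘(ℝ, E) q ∘ (extChartAt 𝓘(ℝ, E) q).symm ∘ x =ᶠ[𝓝 t] x := by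
    intro t ht
    filter_upwards [isOpen_Ioo.mem_nhds ht] with s hs
    exact (extChartAt 𝓘(ℝ, E) q).right_inv (hxT hs)
  refine ⟨(extChartAt 𝓘(ℝ, E) q).symm ∘ x, ε, hε, ⟨isOpen_Ioo, ordConnected_Ioo, hsm, ?_⟩, ?_⟩
  · intro t ht
    rw [magneticEquation_iff hg ((hat t ht).of_le ENat.LEInfty.out) (hsrc t ht),
      magneticDefect_congr _ _ (hback t ht)]
    exact hdef t ht
  · have hq : ((extChartAt 𝓘(ℝ, E) q).symm ∘ x) 0 = q := by simp [hx0]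
    have hv := coord_velocity ((hat 0 h0).mdifferentiableAt (by simp)) (hsrc 0 h0)
    rw [(hback 0 h0).deriv_eq, hx1] at hv
    refine Bundle.TotalSpace.mk.injEq .. ▸ ⟨hq, ?_⟩
    -- The type of the velocity depends on the base point, so it is made a variable before the base
    -- point is replaced by `q`.
    generalize velocity (E := E) ((extChartAt 𝓘(ℝ, E) q).symm ∘ x) 0 = w at hv
    revert w
    rw [hq]
    intro w hv
    rw [coord_self] at hv
    exact heq_of_eq hv

theorem IsMagneticGeodesicOn.eventuallyEq [FiniteDimensional ℝ E] {g σ : TwoTensor E M}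
    (hg : IsRiemannianMetric g) (hσ : IsSmoothTensor σ) {γ c : ℝ → M} {J K : Set ℝ}
    (hγ : IsMagneticGeodesicOn g σ γ J) (hc : IsMagneticGeodesicOn g σ c K) {t : ℝ}
    (htJ : t ∈ J) (htK : t ∈ K)
    (h : (⟨γ t, velocity γ t⟩ : TangentBundle 𝓘(ℝ, E) M) = ⟨c t, velocity c t⟩) :
    γ =ᶠ[𝓝 t] c := by
  have : CompleteSpace E := FiniteDimensional.complete ℝ E
  have key : ∀ {γ : ℝ → M} {J : Set ℝ}, IsMagneticGeodesicOn g σ γ J → ∀ s ∈ J,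
      ContMDiffAt 𝓘(ℝ, ℝ) 𝓘(ℝ, E) 2 γ s := fun hγ s hs =>
    ((hγ.smooth s hs).contMDiffAt (hγ.isOpen.mem_nhds hs)).of_le ENat.LEInfty.out
  obtain ⟨h1, h2⟩ := (Bundle.TotalSpace.mk.injEq ..).mp h
  have hqγ := mem_extChartAt_source (I := 𝓘(ℝ, E)) (γ t)
  have hqc : c t ∈ (extChartAt 𝓘(ℝ, E) (γ t)).source := h1 ▸ hqγ
  have hev : ∀ {c : ℝ → M} {J : Set ℝ}, IsMagneticGeodesicOn g σ c J → t ∈ J →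
      c t ∈ (extChartAt 𝓘(ℝ, E) (γ t)).source →
      ∀ᶠ s in 𝓝 t, magneticDefect (inChart g (γ t)) (inChart σ (γ t))
        (extChartAt 𝓘(ℝ, E) (γ t) ∘ c) s = 0 := by
    intro c J hc ht hq
    filter_upwards [hc.isOpen.mem_nhds ht,
      eventually_mem_extChartAt_source (key hc t ht).continuousAt hq] with s hs hs'
    exact (magneticEquation_iff hg (key hc s hs) hs').1 (hc.equation s hs)
  have heq := eventuallyEq_of_magneticDefect_eq_zero
    (isOpen_extChartAt_target (I := 𝓘(ℝ, E)) (γ t)) (hg.smooth _) (hσ _) (hg.isInvertible _)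
    (contDiffAt_extChartAt_comp ENat.LEInfty.out (key hγ t htJ) hqγ)
    (contDiffAt_extChartAt_comp ENat.LEInfty.out (key hc t htK) hqc)
    ((extChartAt 𝓘(ℝ, E) (γ t)).map_source hqγ)
    (congrArg (extChartAt 𝓘(ℝ, E) (γ t)) h1) ?_ (hev hγ htJ hqγ) (hev hc htK hqc)
  · filter_upwards [heq, eventually_mem_extChartAt_source (key hγ t htJ).continuousAt hqγ,
      eventually_mem_extChartAt_source (key hc t htK).continuousAt hqc] with s hs h1 h2
    exact (extChartAt 𝓘(ℝ, E) (γ t)).injOn h1 h2 hs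
  · rw [← coord_velocity ((key hγ t htJ).mdifferentiableAt two_ne_zero) hqγ,
      ← coord_velocity ((key hc t htK).mdifferentiableAt two_ne_zero) hqc]
    unfold coord
    rw [h]

end Curves

/-! ### The second fundamental form in charts and the Gauss formula. -/

section SubmanifoldGeometry

/-- The differential at `q` of the preferred chart around `q` is the identity, so the chain rule
leaves only `Dh`. -/
theorem mvfderiv_comp_extChartAt {F : Type*} [NormedAddCommGroup F] [NormedSpace ℝ F]
    {N : Type*} [TopologicalSpace N] [ChartedSpace F N] [IsManifold 𝓘(ℝ, F) ∞ N]
    {W : Type*} [NormedAddCommGroup W] [NormedSpace ℝ W] {h : F → W} {k : N → W} {q : N}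
    (hk : k =ᶠ[𝓝 q] h ∘ extChartAt 𝓘(ℝ, F) q)
    (hh : DifferentiableAt ℝ h (extChartAt 𝓘(ℝ, F) q q)) (v : F) :
    mvfderiv 𝓘(ℝ, F) k q v = fderiv ℝ h (extChartAt 𝓘(ℝ, F) q q) v := by
  have hq := mem_extChartAt_source (I := 𝓘(ℝ, F)) q
  have h1 := mfderiv_comp q (I := 𝓘(ℝ, F)) (I' := 𝓘(ℝ, F)) (I'' := 𝓘(ℝ, W))
    hh.mdifferentiableAt (mdifferentiableAt_extChartAt_of_mem hq)
  have h2 := congrArg (fun l : F →L[ℝ] W => l v)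
    ((hk.mfderiv_eq (I := 𝓘(ℝ, F)) (I' := 𝓘(ℝ, W))).trans h1)
  refine Eq.trans h2 ?_
  have h3 : mfderiv 𝓘(ℝ, F) 𝓘(ℝ, F) (extChartAt 𝓘(ℝ, F) q) q v = v :=
    (coord_eq_mfderiv hq v).symm.trans (coord_self q v)
  rw [mfderiv_eq_fderiv]
  exact congrArg (fderiv ℝ h (extChartAt 𝓘(ℝ, F) q q)) h3

variable {E : Type*} [NormedAddCommGroup E] [NormedSpace ℝ E]
  {M : Type*} [TopologicalSpace M] [ChartedSpace E M] [IsManifold 𝓘(ℝ, E) ∞ M]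
  {F : Type*} [NormedAddCommGroup F] [NormedSpace ℝ F]
  {N : Set M} [ChartedSpace F N] [IsManifold 𝓘(ℝ, F) ∞ N]

variable (E F) in
/-- The inclusion of a submanifold, in the preferred charts around `q`. -/
abbrev inclInChart (q : N) : F → E := mapInChart E F (Subtype.val : N → M) q (q : M)

theorem dIncl_eq_fderiv (hι : ContMDiff 𝓘(ℝ, F) 𝓘(ℝ, E) ∞ (Subtype.val : N → M)) (q : N)
    (v : TangentSpace 𝓘(ℝ, F) q) :
    dIncl (E := E) F N q v = fderiv ℝ (inclInChart E F q) (extChartAt 𝓘(ℝ, F) q q) v := by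
  have h := fderiv_mapInChart_coord ((hι q).of_le ENat.LEInfty.out)
    (mem_extChartAt_source q) (mem_extChartAt_source (q : M)) v
  rw [coord_self, coord_self] at h
  exact h.symm

/-- Write `j` for the inclusion in charts. The extension `V` has constant coefficients `v`, so `dι
V` reads `y ↦ Dj(y) v`, with derivative `D²j(v, v)`, while `∇^N_v V` reduces to its Christoffel
term. -/
theorem secondFundamentalForm_eq (hι : ContMDiff 𝓘(ℝ, F) 𝓘(ℝ, E) ∞ (Subtype.val : N → M))
    (g : TwoTensor E M) (q : N) (v : F) :
    secondFundamentalForm F N g q v =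
      (fderiv ℝ (fderiv ℝ (inclInChart E F q)) (extChartAt 𝓘(ℝ, F) q q) v v
        + christoffel g (q : M) (fderiv ℝ (inclInChart E F q) (extChartAt 𝓘(ℝ, F) q q) v)
            (fderiv ℝ (inclInChart E F q) (extChartAt 𝓘(ℝ, F) q q) v)
        - fderiv ℝ (inclInChart E F q) (extChartAt 𝓘(ℝ, F) q q)
            (christoffel (restrictTensor F N g) q v v) : E) := by
  have hq := mem_extChartAt_source (I := 𝓘(ℝ, F)) q
  have hqM := mem_extChartAt_source (I := 𝓘(ℝ, E)) (q : M)
  have hsm : ContDiffAt ℝ ∞ (inclInChart E F q) (extChartAt 𝓘(ℝ, F) q q) :=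
    contDiffAt_mapInChart le_rfl (hι q) hq hqM
  have hd := dIncl_eq_fderiv hι q v
  have hcoord : coord q q v = v := coord_self q v
  have hV : (ofCoord q q (coord q q v) : TangentSpace 𝓘(ℝ, F) q) = v := ofCoord_coord hq v
  have e1 : (covDerivAlong g (Subtype.val : N → M)
        (fun p => dIncl F N p (ofCoord q p (coord q q v))) q v : E) =
      fderiv ℝ (fderiv ℝ (inclInChart E F q)) (extChartAt 𝓘(ℝ, F) q q) v v
        + christoffel g (q : M) (fderiv ℝ (inclInChart E F q) (extChartAt 𝓘(ℝ, F) q q) v)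
            (fderiv ℝ (inclInChart E F q) (extChartAt 𝓘(ℝ, F) q q) v) := by
    refine (ofCoord_self (q : M) _).trans ?_
    have hk : (fun p : N => coord (q : M) (p : M)
        (dIncl (E := E) F N p (ofCoord q p (coord q q v)))) =ᶠ[𝓝 q]
        (fun y => fderiv ℝ (inclInChart E F q) y v) ∘ extChartAt 𝓘(ℝ, F) q := by
      filter_upwards [(isOpen_extChartAt_source (I := 𝓘(ℝ, F)) q).mem_nhds hq,
        continuous_subtype_val.continuousAt.eventually
          ((isOpen_extChartAt_source (I := 𝓘(ℝ, E)) (q : M)).mem_nhds hqM)] with p hp hpM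
      rw [hcoord]
      exact (fderiv_mapInChart ((hι p).of_le ENat.LEInfty.out) hp hpM v).symm
    have hdiff : DifferentiableAt ℝ (fderiv ℝ (inclInChart E F q)) (extChartAt 𝓘(ℝ, F) q q) :=
      ((hsm.of_le (m := 2) ENat.LEInfty.out).fderiv_right (m := 1) (by norm_num)).differentiableAt one_ne_zero
    have hmv := mvfderiv_comp_extChartAt hk (hdiff.clm_apply (differentiableAt_const _)) v
    have hder : fderiv ℝ (fun y => fderiv ℝ (inclInChart E F q) y v) (extChartAt 𝓘(ℝ, F) q q) v =
        fderiv ℝ (fderiv ℝ (inclInChart E F q)) (extChartAt 𝓘(ℝ, F) q q) v v := by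
      rw [fderiv_clm_apply hdiff (differentiableAt_const _)]
      simp
    exact congrArg₂ (fun a b : E => a + b) (hmv.trans hder)
      (congrArg₂ (christoffel g (q : M)) ((coord_self (q : M) _).trans hd)
        ((coord_self (q : M) _).trans ((congrArg (dIncl F N q) hV).trans hd)))
  have e2 : (leviCivita (restrictTensor F N g) (fun p => ofCoord q p (coord q q v)) q v : F) =
      christoffel (restrictTensor F N g) q v v := by
    refine (ofCoord_self q _).trans ?_
    have hk : (fun p : N => coord q p (ofCoord q p (coord q q v))) =ᶠ[𝓝 q]
        (fun _ => v) ∘ extChartAt 𝓘(ℝ, F) q := by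
      filter_upwards [(isOpen_extChartAt_source (I := 𝓘(ℝ, F)) q).mem_nhds hq] with p hp
      rw [hcoord]
      exact coord_ofCoord hp v
    have hid : mfderiv 𝓘(ℝ, F) 𝓘(ℝ, F) (fun p : N => p) q v = v :=
      congrArg (fun l : F →L[ℝ] F => l v) (mfderiv_id (I := 𝓘(ℝ, F)) (x := q))
    have hmv := mvfderiv_comp_extChartAt hk (differentiableAt_const _) v
    have h0 : fderiv ℝ (fun _ : F => v) (extChartAt 𝓘(ℝ, F) q q) v = 0 := by simp
    exact (congrArg₂ (fun a b : F => a + b) (hmv.trans h0)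
      (congrArg₂ (christoffel (restrictTensor F N g) q) ((coord_self q _).trans hid)
        ((coord_self q _).trans hV))).trans (zero_add _)
  have e3 := (dIncl_eq_fderiv hι q
    (leviCivita (restrictTensor F N g) (fun p => ofCoord q p (coord q q v)) q v)).trans
    (congrArg (fderiv ℝ (inclInChart E F q) (extChartAt 𝓘(ℝ, F) q q)) e2)
  exact congrArg₂ (fun a b : E => a - b) e1 e3

theorem christoffel_neg_neg (g : TwoTensor E M) (q : M) (u : E) :
    christoffel g q (-u) (-u) = christoffel g q u u := by
  have h : christoffelFirst g q (-u) (-u) = christoffelFirst g q u u := by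
    ext w
    simp [christoffelFirst]
    ring
  rw [christoffel, christoffel, h]

/-- The second fundamental form is even, being quadratic. -/
theorem secondFundamentalForm_neg (hι : ContMDiff 𝓘(ℝ, F) 𝓘(ℝ, E) ∞ (Subtype.val : N → M))
    (g : TwoTensor E M) (q : N) (v : F) :
    secondFundamentalForm F N g q (-v : F) = secondFundamentalForm F N g q v := by
  refine (secondFundamentalForm_eq hι g q (-v : F)).trans
    (Eq.trans ?_ (secondFundamentalForm_eq hι g q v).symm)
  simp only [map_neg, christoffel_neg_neg, neg_apply, neg_neg]
  rfl

/-- The Gauss formula for curves in a submanifold. -/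
theorem covDerivAlong_velocity_val
    (hι : ContMDiff 𝓘(ℝ, F) 𝓘(ℝ, E) ∞ (Subtype.val : N → M))
    (g : TwoTensor E M) {c : ℝ → N} {t : ℝ} (hc : ContMDiffAt 𝓘(ℝ, ℝ) 𝓘(ℝ, F) 2 c t) :
    covDerivAlong (F := ℝ) (N := ℝ) g (fun s => (c s : M)) (fun s => velocity (fun r => (c r : M)) s)
        t (1 : ℝ) =
      dIncl F N (c t) (covDerivAlong (F := ℝ) (N := ℝ) (restrictTensor F N g) c
        (fun s => velocity c s) t (1 : ℝ))
      + secondFundamentalForm F N g (c t) (velocity c t) := by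
  have hq := mem_extChartAt_source (I := 𝓘(ℝ, F)) (c t)
  have hqM := mem_extChartAt_source (I := 𝓘(ℝ, E)) (c t : M)
  have hc1 : ContMDiffAt 𝓘(ℝ, ℝ) 𝓘(ℝ, F) 1 c t := hc.of_le (by norm_num)
  have hιc : ContMDiffAt 𝓘(ℝ, ℝ) 𝓘(ℝ, E) 1 (fun s => (c s : M)) t :=
    ((hι (c t)).of_le ENat.LEInfty.out).comp t hc1
  have hsm : ContDiffAt ℝ 2 (inclInChart E F (c t)) (extChartAt 𝓘(ℝ, F) (c t) (c t)) :=
    (contDiffAt_mapInChart le_rfl (hι (c t)) hq hqM).of_le ENat.LEInfty.out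
  have hx : ContDiffAt ℝ 2 (extChartAt 𝓘(ℝ, F) (c t) ∘ c) t :=
    contDiffAt_extChartAt_comp ENat.LEInfty.out hc hq
  have ec : extChartAt 𝓘(ℝ, E) (c t : M) ∘ (fun s => (c s : M)) =ᶠ[𝓝 t]
      inclInChart E F (c t) ∘ (extChartAt 𝓘(ℝ, F) (c t) ∘ c) :=
    (hc.continuousAt.eventually (mapInChart_comp_eventuallyEq _ hq)).mono fun _ h => h.symm
  have hv : velocity (E := F) c t = deriv (extChartAt 𝓘(ℝ, F) (c t) ∘ c) t := by
    rw [← coord_velocity (hc1.mdifferentiableAt one_ne_zero) hq, coord_self]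
  have e1 := covDerivAlong_velocity g hιc
  -- The chain rule turns the second derivative of `j ∘ x` into `D²j(ẋ, ẋ) + Dj ẍ`. Adding and
  -- subtracting `Dj Γ^N(ẋ, ẋ)` then separates the acceleration in `N` from `II(ẋ)`.
  rw [ec.deriv.deriv_eq, ec.deriv_eq, deriv_deriv_comp hsm hx,
    (deriv_comp_eventuallyEq hsm hx).self_of_nhds] at e1
  have e2 := (dIncl_eq_fderiv hι (c t) (covDerivAlong (F := ℝ) (N := ℝ) (restrictTensor F N g) c
        (fun s => velocity c s) t (1 : ℝ))).trans
    (congrArg (fderiv ℝ (inclInChart E F (c t)) (extChartAt 𝓘(ℝ, F) (c t) (c t)))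
      (covDerivAlong_velocity _ hc1))
  have e3 := (congrArg (secondFundamentalForm F N g (c t)) hv).trans
    (secondFundamentalForm_eq hι g (c t) _)
  refine Eq.trans e1 (Eq.trans ?_ (congrArg₂ (fun a b : E => a + b) e2 e3).symm)
  simp only [Function.comp_apply, map_add]
  abel

end SubmanifoldGeometry

/-! ### Injectivity of the differential of an immersion. -/

section Immersion

variable {E : Type*} [NormedAddCommGroup E] [NormedSpace ℝ E]
  {M : Type*} [TopologicalSpace M] [ChartedSpace E M] [IsManifold 𝓘(ℝ, E) ∞ M]
  {F : Type*} [NormedAddCommGroup F] [NormedSpace ℝ F]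
  {N : Type*} [TopologicalSpace N] [ChartedSpace F N] [IsManifold 𝓘(ℝ, F) ∞ N]

omit [IsManifold 𝓘(ℝ, E) ∞ M] [IsManifold 𝓘(ℝ, F) ∞ N] in
/-- The differential of an immersion is injective. -/
theorem injective_mfderiv_of_isImmersionAt {f : N → M} {x : N}
    (hf : Manifold.IsImmersionAt 𝓘(ℝ, F) 𝓘(ℝ, E) ∞ f x) :
    Function.Injective (mfderiv 𝓘(ℝ, F) 𝓘(ℝ, E) f x) := by
  -- In the normal form `u ↦ (u, 0)` of an immersion, the projection to the first factor is a left
  -- inverse. Hence `L ∘ codChart ∘ f` is `domChart` near `x`, whose differential is injective.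
  let L : E →L[ℝ] F := (ContinuousLinearMap.fst ℝ F hf.complement).comp
    (hf.equiv.symm : E →L[ℝ] F × hf.complement)
  have hcod : ContMDiffAt 𝓘(ℝ, E) 𝓘(ℝ, E) ∞ hf.codChart (f x) :=
    (contMDiffOn_of_mem_maximalAtlas hf.codChart_mem_maximalAtlas).contMDiffAt
      (hf.codChart.open_source.mem_nhds hf.mem_codChart_source)
  have hL : ContMDiffAt 𝓘(ℝ, E) 𝓘(ℝ, F) ∞ (L ∘ hf.codChart) (f x) :=
    L.contMDiff.contMDiffAt.comp (f x) hcod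
  have hev : (L ∘ hf.codChart) ∘ f =ᶠ[𝓝 x] hf.domChart := by
    filter_upwards [hf.domChart.open_source.mem_nhds hf.mem_domChart_source] with z hz
    have hz' : hf.domChart z ∈ (hf.domChart.extend 𝓘(ℝ, F)).target := by
      simpa using! hf.domChart.map_source hz
    have h := hf.writtenInCharts hz'
    simp only [Function.comp_apply, OpenPartialHomeomorph.extend_coe_symm,
      OpenPartialHomeomorph.extend_coe, modelWithCornersSelf_coe, id,
      modelWithCornersSelf_coe_symm, hf.domChart.left_inv hz] at h
    simp [L, h]
  have h1 := mfderiv_comp x (hL.mdifferentiableAt (by simp))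
    (hf.contMDiffAt.mdifferentiableAt (by simp))
  have h2 := (hev.mfderiv_eq (I := 𝓘(ℝ, F)) (I' := 𝓘(ℝ, F))).symm.trans h1
  have h3 : Function.Injective (mfderiv 𝓘(ℝ, F) 𝓘(ℝ, F) hf.domChart x) :=
    OpenPartialHomeomorph.MDifferentiable.mfderiv_injective
      ⟨(contMDiffOn_of_mem_maximalAtlas hf.domChart_mem_maximalAtlas).mdifferentiableOn (by simp),
        (contMDiffOn_symm_of_mem_maximalAtlas hf.domChart_mem_maximalAtlas).mdifferentiableOn
          (by simp)⟩ hf.mem_domChart_source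
  rw [h2] at h3
  exact Function.Injective.of_comp h3

end Immersion

/-! ### Linear algebra of the Lorentz force and the even/odd splitting. -/

section LorentzForce

variable {E : Type*} [NormedAddCommGroup E] [NormedSpace ℝ E] [FiniteDimensional ℝ E]
  {M : Type*} [TopologicalSpace M] [ChartedSpace E M] [IsManifold 𝓘(ℝ, E) ∞ M]

theorem apply_inverse_of_isInvertible {V W : Type*} [NormedAddCommGroup V] [NormedSpace ℝ V]
    [NormedAddCommGroup W] [NormedSpace ℝ W] {B : V →L[ℝ] W} (hB : B.IsInvertible) (w : W) :
    B (B.inverse w) = w := by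
  obtain ⟨e, rfl⟩ := hB
  simp

theorem IsRiemannianMetric.apply_lorentzForce {g : TwoTensor E M} (hg : IsRiemannianMetric g)
    (σ : TwoTensor E M) (q : M) (u : TangentSpace 𝓘(ℝ, E) q) :
    g q (lorentzForce g σ q u) = σ q u :=
  apply_inverse_of_isInvertible (V := E) (W := E →L[ℝ] ℝ)
    (isInvertible_of_pos (V := E) (g q) (hg.pos q)) (σ q u)

variable {F : Type*} [NormedAddCommGroup F] [NormedSpace ℝ F] [FiniteDimensional ℝ F]
  {N : Set M} [ChartedSpace F N] [IsManifold 𝓘(ℝ, F) ∞ N]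

theorem lorentzForce_tfae {g σ : TwoTensor E M} (hg : IsRiemannianMetric g)
    (hgN : IsRiemannianMetric (restrictTensor F N g)) :
    List.TFAE [LorentzForcesAgree F N g σ, LorentzForcePreservesTangent F N g σ,
      NormalIsFieldOrthogonal F N g σ] := by
  tfae_have 1 → 2 := by
    rintro h q _ ⟨u, rfl⟩
    exact ⟨_, h q u⟩
  tfae_have 2 → 3 := by
    intro h q u hu v hv
    rw [← hg.apply_lorentzForce σ q u]
    exact hv _ (h q u hu)
  tfae_have 3 → 1 := by
    intro h q u
    have hN : ∀ w : TangentSpace 𝓘(ℝ, F) q,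
        g (q : M) (dIncl F N q (lorentzForce (restrictTensor F N g) (restrictTensor F N σ) q u))
          (dIncl F N q w) = σ (q : M) (dIncl F N q u) (dIncl F N q w) := fun w =>
      congrArg (fun l : F →L[ℝ] ℝ => l w) (hgN.apply_lorentzForce (restrictTensor F N σ) q u)
    set y := lorentzForce g σ (q : M) (dIncl F N q u) with hy
    set z := dIncl (E := E) F N q
      (lorentzForce (restrictTensor F N g) (restrictTensor F N σ) q u) with hz
    -- Against tangent vectors, `y` and `z` both pair to `σ(u, ·)`, so `y - z` is normal to `N`.
    have hperp : ∀ w ∈ tangentSubspace (E := E) F N q, g (q : M) w (y - z) = 0 := by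
      rintro _ ⟨w, rfl⟩
      rw [hg.symm, map_sub, sub_apply, hy, hg.apply_lorentzForce, sub_eq_zero]
      exact (hN w).symm
    -- Here (c) enters, with the normal vector `y - z`. As `z` is tangent, `y` and `z` are both
    -- orthogonal to `y - z`, which therefore has norm zero.
    have h1 : g (q : M) y (y - z) = 0 := by
      rw [hy, hg.apply_lorentzForce]
      exact h q _ ⟨u, rfl⟩ _ hperp
    have h2 : g (q : M) z (y - z) = 0 := hperp _ ⟨_, rfl⟩
    by_contra hne
    have h3 := hg.pos (q : M) (y - z) (sub_ne_zero.2 (Ne.symm hne))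
    rw [map_sub, hg.symm _ (y - z) y, hg.symm _ (y - z) z, h1, h2, sub_self] at h3
    exact h3.false
  tfae_finish

omit [FiniteDimensional ℝ E] [FiniteDimensional ℝ F] in
/-- The infinitesimal form of total magneticity: `Y^N v + II(v) = Y^M v`. -/
theorem secondFundamentalFormVanishes_and_lorentzForcesAgree_iff
    (hι : ContMDiff 𝓘(ℝ, F) 𝓘(ℝ, E) ∞ (Subtype.val : N → M)) {g σ : TwoTensor E M} :
    (SecondFundamentalFormVanishes F N g ∧ LorentzForcesAgree F N g σ) ↔
      ∀ z : TangentBundle 𝓘(ℝ, F) N,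
        dIncl F N z.1 (lorentzForce (restrictTensor F N g) (restrictTensor F N σ) z.1 z.2)
          + secondFundamentalForm F N g z.1 z.2 = lorentzForce g σ (z.1 : M) (dIncl F N z.1 z.2) := by
  refine ⟨fun ⟨h1, h2⟩ z => by rw [h1, h2, add_zero], fun h => ?_⟩
  have key : SecondFundamentalFormVanishes F N g := by
    intro q v
    have h1 := h ⟨q, v⟩
    -- At `-v` the Lorentz terms change sign and `II` does not; comparison with `h1` gives `II(v) =
    -- -II(v)`.
    have h2 := h ⟨q, -v⟩
    have h3 : secondFundamentalForm F N g q (-v) = secondFundamentalForm F N g q v :=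
      secondFundamentalForm_neg hι g q v
    simp only [map_neg] at h2
    rw [h3, ← h1, neg_add] at h2
    have h4 : (2 : ℝ) • secondFundamentalForm F N g q v = 0 := by
      rw [two_smul]
      nth_rewrite 1 [add_left_cancel h2]
      exact neg_add_cancel _
    exact (smul_eq_zero.1 h4).resolve_left two_ne_zero
  refine ⟨key, fun q v => ?_⟩
  rw [← h ⟨q, v⟩, key, add_zero]

end LorentzForce

/-! ### Curves of `N` that are magnetic geodesics of `M`. -/

section MainTheorem

variable {E : Type*} [NormedAddCommGroup E] [NormedSpace ℝ E] [FiniteDimensional ℝ E]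
  {M : Type*} [TopologicalSpace M] [ChartedSpace E M] [IsManifold 𝓘(ℝ, E) ∞ M]
  {F : Type*} [NormedAddCommGroup F] [NormedSpace ℝ F] [FiniteDimensional ℝ F]
  {N : Set M} [ChartedSpace F N] [IsManifold 𝓘(ℝ, F) ∞ N] {g σ : TwoTensor E M}

omit [FiniteDimensional ℝ E] [FiniteDimensional ℝ F] [IsManifold 𝓘(ℝ, E) ∞ M]
  [IsManifold 𝓘(ℝ, F) ∞ N] in
theorem velocity_val (hι : ContMDiff 𝓘(ℝ, F) 𝓘(ℝ, E) ∞ (Subtype.val : N → M)) {c : ℝ → N} {t : ℝ}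
    (hc : MDifferentiableAt 𝓘(ℝ, ℝ) 𝓘(ℝ, F) c t) :
    velocity (E := E) (fun s => (c s : M)) t = dIncl F N (c t) (velocity c t) := by
  have h := mfderiv_comp t (I := 𝓘(ℝ, ℝ)) (I' := 𝓘(ℝ, F)) (I'' := 𝓘(ℝ, E))
    ((hι (c t)).mdifferentiableAt (by simp)) hc
  exact congrArg (fun l : ℝ →L[ℝ] E => l 1) h

/-- A curve of `N` that solves the magnetic geodesic equation of `M` solves the one of `N`. -/
theorem magneticEquation_of_val (hι : ContMDiff 𝓘(ℝ, F) 𝓘(ℝ, E) ∞ (Subtype.val : N → M))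
    (hg : IsRiemannianMetric g) (hgN : IsRiemannianMetric (restrictTensor F N g))
    {c : ℝ → N} {t : ℝ} (hc : ContMDiffAt 𝓘(ℝ, ℝ) 𝓘(ℝ, F) 2 c t)
    (h : covDerivAlong (F := ℝ) (N := ℝ) g (fun s => (c s : M))
        (fun s => velocity (fun r => (c r : M)) s) t (1 : ℝ)
      = lorentzForce g σ (c t) (velocity (fun s => (c s : M)) t)) :
    covDerivAlong (F := ℝ) (N := ℝ) (restrictTensor F N g) c (fun s => velocity c s) t (1 : ℝ)
      = lorentzForce (restrictTensor F N g) (restrictTensor F N σ) (c t) (velocity c t) := by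
  have hq := mem_extChartAt_source (I := 𝓘(ℝ, F)) (c t)
  have hqM := mem_extChartAt_source (I := 𝓘(ℝ, E)) (c t : M)
  have hιc : ContMDiffAt 𝓘(ℝ, ℝ) 𝓘(ℝ, E) 2 (fun s => (c s : M)) t :=
    ((hι (c t)).of_le ENat.LEInfty.out).comp t hc
  rw [magneticEquation_iff hgN hc hq]
  have h' := (magneticEquation_iff hg hιc hqM).1 h
  -- The defect in `N` tested on `w` is the defect in `M` tested on the image of `w` under the
  -- differential of the inclusion, hence zero.
  ext w
  refine (magneticDefect_pullbackTensor hg hι hc hq hqM w).trans ?_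
  exact congrArg (fun l : E →L[ℝ] ℝ => l _) h'

omit [FiniteDimensional ℝ E] [FiniteDimensional ℝ F] in
theorem gauss_relation_of_val (hι : ContMDiff 𝓘(ℝ, F) 𝓘(ℝ, E) ∞ (Subtype.val : N → M))
    {c : ℝ → N} {t : ℝ} (hc : ContMDiffAt 𝓘(ℝ, ℝ) 𝓘(ℝ, F) 2 c t)
    (hM : covDerivAlong (F := ℝ) (N := ℝ) g (fun s => (c s : M))
        (fun s => velocity (fun r => (c r : M)) s) t (1 : ℝ)
      = lorentzForce g σ (c t) (velocity (fun s => (c s : M)) t))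
    (hN : covDerivAlong (F := ℝ) (N := ℝ) (restrictTensor F N g) c (fun s => velocity c s) t (1 : ℝ)
      = lorentzForce (restrictTensor F N g) (restrictTensor F N σ) (c t) (velocity c t)) :
    dIncl F N (c t) (lorentzForce (restrictTensor F N g) (restrictTensor F N σ) (c t)
        (velocity c t)) + secondFundamentalForm F N g (c t) (velocity c t)
      = lorentzForce g σ (c t : M) (dIncl F N (c t) (velocity c t)) := by
  rw [← hN, ← covDerivAlong_velocity_val hι g hc, hM,
    velocity_val hι (hc.mdifferentiableAt two_ne_zero)]

end MainTheorem

/-! ### The implications between the three characterisations. -/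

section Equivalences

variable {E : Type*} [NormedAddCommGroup E] [NormedSpace ℝ E] [FiniteDimensional ℝ E]
  {M : Type*} [TopologicalSpace M] [ChartedSpace E M] [IsManifold 𝓘(ℝ, E) ∞ M]
  {F : Type*} [NormedAddCommGroup F] [NormedSpace ℝ F] [FiniteDimensional ℝ F]
  {N : Set M} [ChartedSpace F N] [IsManifold 𝓘(ℝ, F) ∞ N] {g σ : TwoTensor E M}

omit [FiniteDimensional ℝ E] in
theorem IsMagneticGeodesicOn.contMDiffAt {γ : ℝ → M} {J : Set ℝ}
    (hγ : IsMagneticGeodesicOn g σ γ J) {t : ℝ} (ht : t ∈ J) :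
    ContMDiffAt 𝓘(ℝ, ℝ) 𝓘(ℝ, E) ∞ γ t :=
  (hγ.smooth t ht).contMDiffAt (hγ.isOpen.mem_nhds ht)

omit [FiniteDimensional ℝ E] [FiniteDimensional ℝ F] in
theorem isMagneticGeodesicOn_val (hι : ContMDiff 𝓘(ℝ, F) 𝓘(ℝ, E) ∞ (Subtype.val : N → M))
    (hII : SecondFundamentalFormVanishes F N g) (hY : LorentzForcesAgree F N g σ)
    {c : ℝ → N} {J : Set ℝ}
    (hc : IsMagneticGeodesicOn (restrictTensor F N g) (restrictTensor F N σ) c J) :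
    IsMagneticGeodesicOn g σ (fun t => (c t : M)) J where
  isOpen := hc.isOpen
  ordConnected := hc.ordConnected
  smooth := hι.comp_contMDiffOn hc.smooth
  equation t ht := by
    have hct := (hc.contMDiffAt ht).of_le (n := ∞) (m := 2) ENat.LEInfty.out
    rw [covDerivAlong_velocity_val hι g hct, hII, add_zero, hc.equation t ht, hY,
      velocity_val hι (hct.mdifferentiableAt two_ne_zero)]

omit [FiniteDimensional ℝ E] [FiniteDimensional ℝ F] [IsManifold 𝓘(ℝ, E) ∞ M]
  [IsManifold 𝓘(ℝ, F) ∞ N] in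
theorem tangentBundle_ext_of_dIncl (hinj : ∀ q, Function.Injective (dIncl (E := E) F N q))
    {y z : TangentBundle 𝓘(ℝ, F) N}
    (h : (⟨y.1, dIncl F N y.1 y.2⟩ : TangentBundle 𝓘(ℝ, E) M) = ⟨z.1, dIncl F N z.1 z.2⟩) :
    y = z := by
  obtain ⟨p, v⟩ := y
  obtain ⟨q, w⟩ := z
  obtain ⟨h1, h2⟩ := (Bundle.TotalSpace.mk.injEq ..).mp h
  obtain rfl : p = q := Subtype.ext h1
  exact congrArg (Bundle.TotalSpace.mk p) (hinj p (eq_of_heq h2))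

theorem secondFundamentalFormVanishes_of_isTotallyMagnetic
    (hemb : Manifold.IsSmoothEmbedding 𝓘(ℝ, F) 𝓘(ℝ, E) ∞ (Subtype.val : N → M))
    (hg : IsRiemannianMetric g) (hgN : IsRiemannianMetric (restrictTensor F N g))
    (hσ : IsSmoothTensor σ) (hinj : ∀ q, Function.Injective (dIncl (E := E) F N q))
    (h : IsTotallyMagnetic F N g σ) :
    SecondFundamentalFormVanishes F N g ∧ LorentzForcesAgree F N g σ := by
  have hι := hemb.contMDiff
  refine (secondFundamentalFormVanishes_and_lorentzForcesAgree_iff hι).2 fun z => ?_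
  obtain ⟨γ, δ, hδ, hγ, hγz⟩ := exists_isMagneticGeodesicOn hg hσ (z.1 : M) (dIncl F N z.1 z.2)
  have h0 : (0 : ℝ) ∈ Ioo (-δ) δ := ⟨by linarith, hδ⟩
  obtain ⟨hq, hv⟩ := (Bundle.TotalSpace.mk.injEq ..).mp hγz
  have hqN : γ 0 ∈ N := by rw [hq]; exact z.1.2
  have htan : velocity (E := E) γ 0 ∈ tangentSubspace (E := E) F N ⟨γ 0, hqN⟩ := by
    have h1 : ∀ (x : M) (hx : x ∈ N) (w : TangentSpace 𝓘(ℝ, E) x),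
        (⟨x, w⟩ : TangentBundle 𝓘(ℝ, E) M) = ⟨z.1, dIncl F N z.1 z.2⟩ →
        w ∈ tangentSubspace (E := E) F N ⟨x, hx⟩ := by
      intro x hx w hxw
      obtain ⟨rfl, h2⟩ := (Bundle.TotalSpace.mk.injEq ..).mp hxw
      rw [eq_of_heq h2]
      exact ⟨z.2, rfl⟩
    exact h1 _ hqN _ hγz
  obtain ⟨ε, hε, hεJ, hεN⟩ := h γ _ hγ h0 hqN htan
  classical
  -- Only the germ at `0` matters, and there `γ t ∈ N`; the value `z.1` elsewhere is arbitrary.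
  let c : ℝ → N := fun t => if ht : γ t ∈ N then ⟨γ t, ht⟩ else z.1
  have hcγ : (fun t => (c t : M)) =ᶠ[𝓝 0] γ := by
    filter_upwards [Ioo_mem_nhds (neg_lt_zero.2 hε) hε] with t ht
    simp [c, hεN t ht]
  have hγ0 := hγ.contMDiffAt h0
  have hιc : ContMDiffAt 𝓘(ℝ, ℝ) 𝓘(ℝ, E) ∞ (fun t => (c t : M)) 0 :=
    hγ0.congr_of_eventuallyEq hcγ
  -- Smoothness into `M` passes to `N`: `c` is continuous because `N` carries the subspace topology,
  -- and then smooth because the inclusion is an immersion.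
  have hc : ContMDiffAt 𝓘(ℝ, ℝ) 𝓘(ℝ, F) 2 c 0 :=
    ((ContMDiffAt.iff_comp_isImmersionAt (hemb.isImmersion.isImmersionAt (c 0))).2
      ⟨Topology.IsInducing.subtypeVal.continuousAt_iff.2 hιc.continuousAt, hιc⟩).of_le ENat.LEInfty.out
  have hcz : (⟨c 0, velocity c 0⟩ : TangentBundle 𝓘(ℝ, F) N) = z := by
    refine tangentBundle_ext_of_dIncl hinj ?_
    rw [← hγz, ← mk_velocity_congr hcγ, velocity_val hι (hc.mdifferentiableAt two_ne_zero)]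
  have heq : covDerivAlong (F := ℝ) (N := ℝ) g (fun s => (c s : M))
        (fun s => velocity (fun r => (c r : M)) s) 0 (1 : ℝ)
      = lorentzForce g σ (c 0) (velocity (fun s => (c s : M)) 0) := by
    have hp := mem_extChartAt_source (I := 𝓘(ℝ, E)) (γ 0)
    have hp' : (c 0 : M) ∈ (extChartAt 𝓘(ℝ, E) (γ 0)).source := by
      rw [show (c 0 : M) = γ 0 from hcγ.self_of_nhds]; exact hp
    -- The equations for `c` and `γ` live in the fibres over `c 0` and `γ 0`; in one fixed chart
    -- both become the vanishing of a defect that depends only on the germ.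
    rw [magneticEquation_iff hg (hιc.of_le ENat.LEInfty.out) hp',
      magneticDefect_congr _ _ (hcγ.fun_comp (extChartAt 𝓘(ℝ, E) (γ 0)))]
    exact (magneticEquation_iff hg (hγ0.of_le ENat.LEInfty.out) hp).1 (hγ.equation 0 h0)
  rw [← hcz]
  exact gauss_relation_of_val hι hc heq (magneticEquation_of_val hι hg hgN hc heq)

/-- The magnetic geodesic of `N` with the same initial velocity is one of `M` by hypothesis, so by
uniqueness in `M` it agrees with `γ` near `0`. -/
theorem isTotallyMagnetic_of_geodesics_val
    (hι : ContMDiff 𝓘(ℝ, F) 𝓘(ℝ, E) ∞ (Subtype.val : N → M))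
    (hg : IsRiemannianMetric g) (hgN : IsRiemannianMetric (restrictTensor F N g))
    (hσ : IsSmoothTensor σ) (hσN : IsSmoothTensor (restrictTensor F N σ))
    (h : ∀ (c : ℝ → N) (J : Set ℝ),
      IsMagneticGeodesicOn (restrictTensor F N g) (restrictTensor F N σ) c J →
      IsMagneticGeodesicOn g σ (fun t => (c t : M)) J) :
    IsTotallyMagnetic F N g σ := by
  rintro γ J hγ h0 hq ⟨v, hv⟩
  obtain ⟨c, δ, hδ, hc, hcz⟩ := exists_isMagneticGeodesicOn hgN hσN ⟨γ 0, hq⟩ v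
  have h0' : (0 : ℝ) ∈ Ioo (-δ) δ := ⟨by linarith, hδ⟩
  have hinit : (⟨γ 0, velocity γ 0⟩ : TangentBundle 𝓘(ℝ, E) M) =
      ⟨c 0, velocity (fun t => (c t : M)) 0⟩ := by
    rw [velocity_val hι ((hc.contMDiffAt h0').mdifferentiableAt (by simp)), ← hv]
    exact (congrArg (fun y : TangentBundle 𝓘(ℝ, F) N =>
      (⟨y.1, dIncl F N y.1 y.2⟩ : TangentBundle 𝓘(ℝ, E) M)) hcz).symm
  have hev := hγ.eventuallyEq hg hσ (h c _ hc) h0 h0' hinit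
  obtain ⟨ε, hε, hball⟩ := Metric.eventually_nhds_iff_ball.1
    (hev.and (hγ.isOpen.mem_nhds h0))
  rw [Real.ball_eq_Ioo, zero_sub, zero_add] at hball
  refine ⟨ε, hε, fun t ht => (hball t ht).2, fun t ht => ?_⟩
  rw [(hball t ht).1]
  exact (c t).2

end Equivalences

end Magnetic

end

theorem theorem1p2
    {E : Type*} [NormedAddCommGroup E] [NormedSpace ℝ E] [FiniteDimensional ℝ E]
    {M : Type*} [TopologicalSpace M] [T2Space M] [CompactSpace M] [ConnectedSpace M]
    [ChartedSpace E M] [IsManifold 𝓘(ℝ, E) ∞ M]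
    (S : Magnetic.MagneticSystem E M)
    {F : Type*} [NormedAddCommGroup F] [NormedSpace ℝ F] [FiniteDimensional ℝ F]
    (N : Set M) (hN_closed : IsClosed N) [ChartedSpace F N] [IsManifold 𝓘(ℝ, F) ∞ N]
    (hN : Manifold.IsSmoothEmbedding 𝓘(ℝ, F) 𝓘(ℝ, E) ∞ (Subtype.val : N → M)) :
    List.TFAE [
      Magnetic.IsTotallyMagnetic F N S.metric.inner S.field,
      ∀ (γ : ℝ → N) (J : Set ℝ),
        Magnetic.IsMagneticGeodesicOn (Magnetic.restrictTensor F N S.metric.inner)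
          (Magnetic.restrictTensor F N S.field) γ J →
        Magnetic.IsMagneticGeodesicOn S.metric.inner S.field (fun t => (γ t : M)) J,
      Magnetic.SecondFundamentalFormVanishes F N S.metric.inner ∧
        (Magnetic.LorentzForcesAgree F N S.metric.inner S.field ∨
          Magnetic.LorentzForcePreservesTangent F N S.metric.inner S.field ∨
          Magnetic.NormalIsFieldOrthogonal F N S.metric.inner S.field)] ∧
    List.TFAE [
      Magnetic.LorentzForcesAgree F N S.metric.inner S.field,
      Magnetic.LorentzForcePreservesTangent F N S.metric.inner S.field,
      Magnetic.NormalIsFieldOrthogonal F N S.metric.inner S.field] := by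
  have hι := hN.contMDiff
  have hinj : ∀ q, Function.Injective (Magnetic.dIncl (E := E) F N q) := fun q =>
    Magnetic.injective_mfderiv_of_isImmersionAt (hN.isImmersion.isImmersionAt q)
  have hg : Magnetic.IsRiemannianMetric S.metric.inner :=
    ⟨Magnetic.isSmoothTensor_of_contMDiff S.metric.contMDiff, S.metric.symm, S.metric.pos⟩
  have hσ : Magnetic.IsSmoothTensor S.field := Magnetic.isSmoothTensor_of_contMDiff S.field_smooth
  have hgN : Magnetic.IsRiemannianMetric (Magnetic.restrictTensor F N S.metric.inner) :=
    hg.pullbackTensor hι hinj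
  have hσN : Magnetic.IsSmoothTensor (Magnetic.restrictTensor F N S.field) := hσ.pullbackTensor hι
  have habc := Magnetic.lorentzForce_tfae (F := F) (N := N) (σ := S.field) hg hgN
  refine ⟨?_, habc⟩
  tfae_have 1 → 3 := fun h =>
    (Magnetic.secondFundamentalFormVanishes_of_isTotallyMagnetic hN hg hgN hσ hinj h).imp id Or.inl
  tfae_have 3 → 2 := by
    rintro ⟨hII, h⟩ c J hc
    have hY : Magnetic.LorentzForcesAgree F N S.metric.inner S.field := by
      rcases h with h | h | h
      · exact h
      · exact (habc.out 0 1).2 h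
      · exact (habc.out 0 2).2 h
    exact Magnetic.isMagneticGeodesicOn_val hι hII hY hc
  tfae_have 2 → 1 := Magnetic.isTotallyMagnetic_of_geodesics_val hι hg hgN hσ hσN
  tfae_finish
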